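/- **Setting.** Let $G$ be a compact connected Lie group with a bi-invariant Riemannian metric, $(e_i)$ an orthonormal basis of its Lie algebra $\mathfrak g=T_1G$, identified with the corresponding left-translated vector fields, and $\rho:G\to U(N)$ a (smooth) unitary representation of $G$ in $M_N(\mathbb C)$. Let $S_0\subset S_1\subset\cdots$ be a nested sequence of finite oriented graphs: passing from $S_n$ to $S_{n+1}$, every edge $e$ is subdivided into two edges $e',e''$ (traversed in this order, with the same orientation), and finitely many new edges may be added. Put $\mathcal A_n=G^{e(S_n)}$, with $e(S_n)$ the set of edges of $S_n$; let $P_{n,n+1}:\mathcal A_{n+1}\to\mathcal A_n$ be given by $(P_{n,n+1}g)_e=g_{e'}g_{e''}$ (new edges are forgotten), and $\overline{\mathcal A}=\varprojlim\mathcal A_n$. On $\mathcal A_n$ use the coordinates $\Theta_n(g)_e=g_e\,g_{e_1}\cdots g_{e_r}$, where $e_1,\dots,e_r$ are the edges of $S_n$ that follow $e$ inside the edge of the first graph in which the curve carrying $e$ occurs. In these coordinates $P_{n,n+1}$ deletes the copies of $G$ labelled by the edges of $S_{n+1}$ that are not of the form $e'$ (the *new* coordinates), and the copy labelled by $e'$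 is mapped identically onto the copy labelled by $e$. With the product metric and normalized Haar measure on $\mathcal A_n$, in the new coordinates, let $\mathcal H_n=L^2(\mathcal A_n,M_N(\mathbb C)\otimes Cl(T^*\mathcal A_n))$. Here the Clifford bundle (convention $v\cdot v=-|v|^2$) is trivialized by left translations and has the inner product $\langle x,y\rangle=\mathrm{tr}(x^*y)$ of the normalized trace, and $M_N(\mathbb C)$ has the Hilbert–Schmidt inner product. Pull-back of sections along $P_{n,n+1}$ gives isometries $\mathcal H_n\to\mathcal H_{n+1}$; let $\mathcal H=L^2(\overline{\mathcal A},M_N\otimes Cl(T^*\overline{\mathcal A}))=\varinjlim\mathcal H_n$ be the Hilbert space direct limit. For a coordinate $c$ of $\mathcal A_n$, write $e_i^c$ for $e_i$ on the copy of $G$ labelled by $c$, let $\partial_{e_i^c}$ be the derivative along it (in the left trivialization), and put $D_c=\sum_i e_i^c\cdot\partial_{e_i^c}$, where the dot is Clifford multiplication. Let $a^{n,c}$ be nonzero real numbers. Put $D_0=\sum_{c\in e(S_0)}a^{0,c}D_c$ and $$D_{n}=E_n(D_{n-1})+\sum_{c\ \text{new}}a^{n,c}D_c ,$$ where the sum is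 over the new coordinates of $\mathcal A_n$ and $E_n(D_{n-1})$ is the operator $D_{n-1}$ acting through the coordinates that come from $\mathcal A_{n-1}$. In the same way $D_n$ acts on smooth sections over every $\mathcal A_k$, $k\ge n$. Thus $D_n=\sum_{c\in e(S_n)}\alpha^{n,c}D_c$, with $\alpha^{n,c}$ the coefficient $a^{m,\cdot}$ attached to the coordinate $c$ at the level $m$ where it first occurs. Let $D$ be the operator on $\mathcal H$ whose domain is the space of the smooth sections over the $\mathcal A_n$, $n\ge0$, and which acts as $D_n$ on the smooth sections over $\mathcal A_n$. For a loop $L$ based at a vertex $v$, i.e. a closed path of edges and reversed edges in some $S_n$ (then $L$ is said to live at level $n$), let $h_L:\overline{\mathcal A}\to M_N(\mathbb C)$ be $\rho$ of the holonomy along $L$ (the product of the holonomies along its edges, inverted for reversed edges). It factors through $\mathcal A_n$ and acts on $\mathcal H$ by left multiplication on the factor $M_N(\mathbb C)$. Let $\mathcal B_v$ be the $*$-algebra of operators on $\mathcal H$ generated by the $h_L$, $L$ running through the loops based at $v$. **Proposition.** 1. $D$ is well defined: every smooth section $f$ over $\mathcal A_n$ lies in its domain, and $Df=D_nf$. 2.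 For every $B\in\mathcal B_v$, the operator $B$ preserves the domain of $D$, and the commutator $[B,D]$ extends to a bounded operator on $\mathcal H$. 3. Let $L$ be a loop based at $v$ that lives at level $n$. Then $[h_L,D]$ is bounded, $h_L$ preserves the smooth sections over $\mathcal A_k$ for $k\ge n$, and on these $$[h_L,D]=[h_L,D_k]=[h_L,D_n]=-\sum_{c\in e(S_n)}\alpha^{n,c}\sum_i e_i^c\cdot\partial_{e_i^c}(h_L).$$ So $[h_L,D]$ is an operator of order zero: Clifford multiplication by the derivatives of $h_L$. The bounded extension of $[h_L,D]$ acts in this way on the smooth sections over all $\mathcal A_k$, $k\ge n$. -/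

import Mathlib

/-! ### The Clifford algebra of a Euclidean space and its trace inner product -/

set_option linter.unusedSectionVars false

namespace LoopDirac

section Clifford

variable (W : Type*) [NormedAddCommGroup W] [InnerProductSpace ℝ W]

/-- The quadratic form `v ↦ -‖v‖²`. -/
noncomputable def cliffordForm : QuadraticForm ℝ W :=
  -(LinearMap.BilinMap.toQuadraticMap (innerₗ W))

/-- The real Clifford algebra of a Euclidean space, with the convention `v * v = -‖v‖²` that makes
`∑ eᵢ · ∂ᵢ` formally self-adjoint. -/
def Cl : Type _ := CliffordAlgebra (cliffordForm W)

noncomputable instance : Ring (Cl W) := inferInstanceAs (Ring (CliffordAlgebra (cliffordForm W)))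
noncomputable instance : Algebra ℝ (Cl W) :=
  inferInstanceAs (Algebra ℝ (CliffordAlgebra (cliffordForm W)))
/-- The canonical anti-involution, `v⋆ = -v` for vectors. -/
noncomputable instance : StarRing (Cl W) :=
  inferInstanceAs (StarRing (CliffordAlgebra (cliffordForm W)))

theorem cliffordForm_apply (v : W) : cliffordForm W v = -inner ℝ v v := by
  simp [cliffordForm]

variable {W}

namespace Cl

/-- The inclusion of vectors into the Clifford algebra. -/
noncomputable def vec : W →ₗ[ℝ] Cl W := CliffordAlgebra.ι (cliffordForm W)

theorem star_vec (v : W) : star (vec v) = -vec v := CliffordAlgebra.star_ι v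

theorem star_smul' (r : ℝ) (x : Cl W) : star (r • x) = r • star x :=
  CliffordAlgebra.star_smul r x

theorem vec_mul_self (v : W) : vec v * vec v = algebraMap ℝ (Cl W) (-inner ℝ v v) := by
  rw [← cliffordForm_apply]; exact CliffordAlgebra.ι_sq_scalar (cliffordForm W) v

theorem vec_mul_anti {u v : W} (h : inner ℝ u v = 0) : vec u * vec v = -(vec v * vec u) := by
  apply CliffordAlgebra.ι_mul_ι_comm_of_isOrtho (Q := cliffordForm W)
  rw [QuadraticMap.isOrtho_def]
  simp only [cliffordForm_apply, inner_add_left, inner_add_right, real_inner_comm u v] at *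
  rw [h]; ring

@[elab_as_elim]
theorem ind {C : Cl W → Prop} (h1 : ∀ r, C (algebraMap ℝ (Cl W) r)) (h2 : ∀ v, C (vec v))
    (h3 : ∀ a b, C a → C b → C (a * b)) (h4 : ∀ a b, C a → C b → C (a + b)) (x : Cl W) : C x :=
  CliffordAlgebra.induction (Q := cliffordForm W) (C := C) h1 h2 h3 h4 x

variable {W' : Type*} [NormedAddCommGroup W'] [InnerProductSpace ℝ W']

/-- Functoriality: a linear isometry extends to the Clifford algebras. -/
noncomputable def map (f : W →ₗᵢ[ℝ] W') : Cl W →ₐ[ℝ] Cl W' :=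
  CliffordAlgebra.map (Q₁ := cliffordForm W) (Q₂ := cliffordForm W')
    { toLinearMap := f.toLinearMap
      map_app' := fun m => by simp [cliffordForm_apply] }

theorem map_vec (f : W →ₗᵢ[ℝ] W') (v : W) : map f (vec v) = vec (f v) :=
  CliffordAlgebra.map_apply_ι _ v

theorem star_algebraMap' (r : ℝ) :
    star (algebraMap ℝ (Cl W) r) = algebraMap ℝ (Cl W) r :=
  CliffordAlgebra.star_algebraMap (Q := cliffordForm W) r

theorem map_star (f : W →ₗᵢ[ℝ] W') (x : Cl W) : map f (star x) = star (map f x) := by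
  induction x using ind with
  | h1 r => simp [star_algebraMap']
  | h2 v => simp [star_vec, map_vec]
  | h3 a b ha hb => simp [ha, hb]
  | h4 a b ha hb => simp [ha, hb]

theorem map_map_of_comm {W'' : Type*} [NormedAddCommGroup W''] [InnerProductSpace ℝ W'']
    {V : Type*} [NormedAddCommGroup V] [InnerProductSpace ℝ V]
    (f : W →ₗᵢ[ℝ] W') (g : W' →ₗᵢ[ℝ] W'') (f' : W →ₗᵢ[ℝ] V) (g' : V →ₗᵢ[ℝ] W'')
    (h : ∀ v, g (f v) = g' (f' v)) (x : Cl W) : map g (map f x) = map g' (map f' x) := by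
  induction x using ind with
  | h1 r => simp
  | h2 v => simp [map_vec, h]
  | h3 a b ha hb => simp [ha, hb]
  | h4 a b ha hb => simp [ha, hb]

theorem map_id' (f : W →ₗᵢ[ℝ] W) (h : ∀ v, f v = v) (x : Cl W) : map f x = x := by
  induction x using ind with
  | h1 r => simp
  | h2 v => simp [map_vec, h]
  | h3 a b ha hb => simp [ha, hb]
  | h4 a b ha hb => simp [ha, hb]

/-- The reflection in the hyperplane orthogonal to `u`, on the Clifford algebra. -/
noncomputable def refl (u : W) : Cl W →ₐ[ℝ] Cl W :=
  map ((Submodule.span ℝ {u})ᗮ.reflection).toLinearIsometry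

theorem refl_vec_self (u : W) : refl u (vec u) = -vec u := by
  rw [refl, map_vec, ← map_neg]
  congr 1
  exact Submodule.reflection_orthogonalComplement_singleton_eq_neg u

theorem refl_vec_of_ortho {u v : W} (h : inner ℝ u v = 0) : refl u (vec v) = vec v := by
  rw [refl, map_vec]
  congr 1
  exact Submodule.reflection_mem_subspace_eq_self
    (Submodule.mem_orthogonal_singleton_iff_inner_right.2 h)

variable [FiniteDimensional ℝ W] [FiniteDimensional ℝ W']

instance : FiniteDimensional ℝ (Cl W) := by
  have := Module.Finite.of_basis (stdOrthonormalBasis ℝ W).toBasis.ExteriorAlgebra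
  exact Module.Finite.equiv (CliffordAlgebra.equivExterior (cliffordForm W)).symm

instance : Nontrivial (Cl W) :=
  inferInstanceAs (Nontrivial (CliffordAlgebra (cliffordForm W)))

/-- The normalized trace on the Clifford algebra (the trace of the left regular representation,
divided by the dimension). -/
noncomputable def tr : Cl W →ₗ[ℝ] ℝ :=
  ((Module.finrank ℝ (Cl W) : ℝ)⁻¹) • (LinearMap.trace ℝ (Cl W) ∘ₗ LinearMap.mul ℝ (Cl W))

theorem tr_one : tr (1 : Cl W) = 1 := by
  have h : (LinearMap.mul ℝ (Cl W)) 1 = LinearMap.id := by ext; simp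
  have h2 : (Module.finrank ℝ (Cl W) : ℝ) ≠ 0 := by exact_mod_cast Module.finrank_pos.ne'
  simp [tr, h, h2]

theorem tr_map_equiv (s : W ≃ₗᵢ[ℝ] W) (x : Cl W) : tr (map s.toLinearIsometry x) = tr x := by
  have hl : ∀ y : Cl W, map s.symm.toLinearIsometry (map s.toLinearIsometry y) = y := by
    intro y
    rw [map_map_of_comm _ _ .id .id (fun v => by simp), map_id' _ (fun v => rfl),
      map_id' _ (fun v => rfl)]
  have hr : ∀ y : Cl W, map s.toLinearIsometry (map s.symm.toLinearIsometry y) = y := by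
    intro y
    rw [map_map_of_comm _ _ .id .id (fun v => by simp), map_id' _ (fun v => rfl),
      map_id' _ (fun v => rfl)]
  let e : Cl W ≃ₗ[ℝ] Cl W :=
    { (map s.toLinearIsometry).toLinearMap with
      invFun := map s.symm.toLinearIsometry
      left_inv := hl
      right_inv := hr }
  have h : LinearMap.mul ℝ (Cl W) (map s.toLinearIsometry x)
      = e.conj (LinearMap.mul ℝ (Cl W) x) := by
    ext y
    rw [LinearEquiv.conj_apply_apply]
    change map s.toLinearIsometry x * y =
      map s.toLinearIsometry (x * map s.symm.toLinearIsometry y)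
    rw [map_mul, hr]
  simp [tr, h, LinearMap.trace_conj']

theorem tr_refl (u : W) (x : Cl W) : tr (refl u x) = tr x := tr_map_equiv _ x

section Filtration

variable {ι : Type*} [Fintype ι] [DecidableEq ι] (b : OrthonormalBasis ι ℝ W)

/-- The subalgebra generated by the basis vectors with index in `S`. -/
noncomputable def sub (S : Finset ι) : Subalgebra ℝ (Cl W) :=
  Algebra.adjoin ℝ ((fun i => vec (b i)) '' S)

theorem sub_univ : sub b Finset.univ = ⊤ := by
  rw [eq_top_iff]
  rintro x -
  induction x using ind with
  | h1 r => exact Subalgebra.algebraMap_mem _ r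
  | h2 v =>
    rw [← b.sum_repr v, map_sum]
    refine Subalgebra.sum_mem _ fun i _ => ?_
    rw [map_smul]
    exact Subalgebra.smul_mem _ (Algebra.subset_adjoin (Set.mem_image_of_mem _ (by simp))) _
  | h3 a b ha hb => exact Subalgebra.mul_mem _ ha hb
  | h4 a b ha hb => exact Subalgebra.add_mem _ ha hb

theorem sub_decomp (S : Finset ι) (i : ι) (hi : i ∉ S) {x : Cl W} (hx : x ∈ sub b (insert i S)) :
    ∃ p ∈ sub b S, ∃ q ∈ sub b S, x = p + vec (b i) * q := by
  let D : Set (Cl W) := {x | ∃ p ∈ sub b S, ∃ q ∈ sub b S, x = p + vec (b i) * q}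
  suffices h : ∀ d ∈ D, x * d ∈ D by
    have := h 1 ⟨1, Subalgebra.one_mem _, 0, Subalgebra.zero_mem _, by simp⟩
    rwa [mul_one] at this
  unfold sub at hx
  induction hx using Algebra.adjoin_induction with
  | mem x hx =>
    obtain ⟨j, hj, rfl⟩ := hx
    rintro _ ⟨p, hp, q, hq, rfl⟩
    rcases Finset.mem_insert.1 (Finset.mem_coe.1 hj) with hj | hjS
    · subst hj
      refine ⟨-q, Subalgebra.neg_mem _ hq, p, hp, ?_⟩
      have h := vec_mul_self (b j)
      simp only [real_inner_self_eq_norm_sq, b.norm_eq_one, one_pow, map_neg, map_one] at h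
      simp only [mul_add, ← mul_assoc, h]
      simp [add_comm]
    · have hij : inner ℝ (b j) (b i) = 0 := b.inner_eq_zero (by rintro rfl; exact hi hjS)
      have hj' : vec (b j) ∈ sub b S := Algebra.subset_adjoin ⟨j, hjS, rfl⟩
      refine ⟨vec (b j) * p, Subalgebra.mul_mem _ hj' hp, -(vec (b j) * q),
        Subalgebra.neg_mem _ (Subalgebra.mul_mem _ hj' hq), ?_⟩
      simp only [mul_add, ← mul_assoc, vec_mul_anti hij]
      simp [mul_assoc]
  | algebraMap r =>
    rintro _ ⟨p, hp, q, hq, rfl⟩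
    refine ⟨r • p, Subalgebra.smul_mem _ hp _, r • q, Subalgebra.smul_mem _ hq _, ?_⟩
    rw [← Algebra.smul_def, smul_add, mul_smul_comm]
  | add x y _ _ hx hy =>
    intro d hd
    obtain ⟨p, hp, q, hq, h⟩ := hx d hd
    obtain ⟨p', hp', q', hq', h'⟩ := hy d hd
    refine ⟨p + p', Subalgebra.add_mem _ hp hp', q + q', Subalgebra.add_mem _ hq hq', ?_⟩
    rw [add_mul, h, h', mul_add]; abel
  | mul x y _ _ hx hy =>
    intro d hd
    rw [mul_assoc]
    exact hx _ (hy _ hd)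

theorem refl_of_mem_sub {S : Finset ι} {i : ι} (hi : i ∉ S) {x : Cl W} (hx : x ∈ sub b S) :
    refl (b i) x = x := by
  unfold sub at hx
  induction hx using Algebra.adjoin_induction with
  | mem x hx =>
    obtain ⟨j, hj, rfl⟩ := hx
    exact refl_vec_of_ortho (b.inner_eq_zero (by rintro rfl; exact hi hj))
  | algebraMap r => simp
  | add x y _ _ hx hy => simp [hx, hy]
  | mul x y _ _ hx hy => simp [hx, hy]

theorem vanish (f : Cl W →ₗ[ℝ] ℝ) (hf : ∀ i x, f (refl (b i) x) = f x) {S : Finset ι} {i : ι}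
    (hi : i ∉ S) {p q : Cl W} (hp : refl (b i) p = p) (hq : q ∈ sub b S) :
    f (p * (vec (b i) * q)) = 0 := by
  have h := hf i (p * (vec (b i) * q))
  rw [map_mul (refl (b i)), map_mul (refl (b i)), hp, refl_vec_self, refl_of_mem_sub b hi hq] at h
  simp only [neg_mul, mul_neg, map_neg] at h
  linarith

theorem eq_tr (f : Cl W →ₗ[ℝ] ℝ) (hf : ∀ i x, f (refl (b i) x) = f x) (x : Cl W) :
    f x = f 1 * tr x := by
  have key : ∀ S : Finset ι, ∀ x ∈ sub b S, f x = f 1 * tr x := by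
    intro S
    induction S using Finset.induction_on with
    | empty =>
      intro x hx
      simp only [sub, Finset.coe_empty, Set.image_empty, Algebra.adjoin_empty] at hx
      obtain ⟨r, rfl⟩ := Algebra.mem_bot.1 hx
      simp only [Algebra.algebraMap_eq_smul_one, map_smul, tr_one, smul_eq_mul]; ring
    | insert i S hi ih =>
      intro x hx
      obtain ⟨p, hp, q, hq, rfl⟩ := sub_decomp b S i hi hx
      have h1 := vanish b f hf hi (p := 1) (map_one _) hq
      have h2 := vanish b tr (fun i x => tr_refl _ x) hi (p := 1) (map_one _) hq
      rw [one_mul] at h1 h2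
      rw [map_add, map_add, h1, h2, add_zero, add_zero, ih p hp]
  exact key Finset.univ x (by rw [sub_univ]; trivial)

theorem tr_star_mul_self (S : Finset ι) :
    ∀ x ∈ sub b S, 0 ≤ tr (star x * x) ∧ (tr (star x * x) = 0 → x = 0) := by
  induction S using Finset.induction_on with
  | empty =>
    intro x hx
    simp only [sub, Finset.coe_empty, Set.image_empty, Algebra.adjoin_empty] at hx
    obtain ⟨r, rfl⟩ := Algebra.mem_bot.1 hx
    have : tr (star (algebraMap ℝ (Cl W) r) * algebraMap ℝ (Cl W) r) = r * r := by
      rw [star_algebraMap', ← map_mul, Algebra.algebraMap_eq_smul_one, map_smul, tr_one,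
        smul_eq_mul, mul_one]
    rw [this]
    refine ⟨mul_self_nonneg r, fun h => ?_⟩
    rw [mul_self_eq_zero.1 h, map_zero]
  | insert i S hi ih =>
    intro x hx
    obtain ⟨p, hp, q, hq, rfl⟩ := sub_decomp b S i hi hx
    have hstar : ∀ {y}, y ∈ sub b S → refl (b i) (star y) = star y := fun {y} hy => by
      rw [refl, map_star, ← refl, refl_of_mem_sub b hi hy]
    have h1 := vanish b tr (fun i x => tr_refl _ x) hi (hstar hp) hq
    have h2 := vanish b tr (fun i x => tr_refl _ x) hi (hstar hq) hp
    have he : star q * (star (vec (b i)) * (vec (b i) * q)) = star q * q := by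
      have h := vec_mul_self (b i)
      simp only [real_inner_self_eq_norm_sq, b.norm_eq_one, one_pow, map_neg, map_one] at h
      rw [star_vec, ← mul_assoc (-vec (b i)), neg_mul, h, neg_neg, one_mul]
    have h3 : tr (star (p + vec (b i) * q) * (p + vec (b i) * q))
        = tr (star p * p) + tr (star q * q) := by
      rw [star_add, star_mul, add_mul, mul_add, mul_add, mul_assoc (star q), mul_assoc (star q),
        he, star_vec, neg_mul, mul_neg]
      simp only [map_add, map_neg, h1, h2]
      ring
    obtain ⟨hp1, hp2⟩ := ih p hp
    obtain ⟨hq1, hq2⟩ := ih q hq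
    rw [h3]
    refine ⟨add_nonneg hp1 hq1, fun h => ?_⟩
    rw [hp2 (by linarith), hq2 (by linarith)]
    simp

end Filtration

theorem tr_star (x : Cl W) : tr (star x) = tr x := by
  classical
  let f : Cl W →ₗ[ℝ] ℝ :=
    { toFun := fun x => tr (star x)
      map_add' := fun x y => by simp
      map_smul' := fun r x => by simp [star_smul'] }
  have h := eq_tr (stdOrthonormalBasis ℝ W) f (fun i x => by
    change tr (star (refl _ x)) = tr (star x)
    rw [refl, ← map_star, ← refl, tr_refl]) x
  have h1 : f 1 = 1 := by change tr (star 1) = 1; rw [star_one, tr_one]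
  rw [h1, one_mul] at h
  exact h

theorem tr_map (f : W →ₗᵢ[ℝ] W') (x : Cl W) : tr (map f x) = tr x := by
  classical
  have h := eq_tr (stdOrthonormalBasis ℝ W) (tr ∘ₗ (map f).toLinearMap) (fun i x => by
    set u := stdOrthonormalBasis ℝ W i
    change tr (map f (refl u x)) = tr (map f x)
    rw [← tr_refl (f u) (map f x), refl, refl]
    congr 1
    apply map_map_of_comm
    intro v
    change f ((Submodule.span ℝ {u})ᗮ.reflection v) = (Submodule.span ℝ {f u})ᗮ.reflection (f v)
    rw [Submodule.reflection_orthogonal, Submodule.reflection_orthogonal]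
    simp [Submodule.reflection_singleton_apply]) x
  simpa [tr_one] using h

/-- The trace inner product `⟪x, y⟫ = tr (x⋆ y)`; for it the products of distinct orthonormal
vectors are orthonormal. -/
@[reducible]
noncomputable def innerCore : InnerProductSpace.Core ℝ (Cl W) where
  inner x y := tr (star x * y)
  conj_inner_symm x y := by
    change tr (star y * x) = tr (star x * y)
    rw [← tr_star (star y * x), star_mul, star_star]
  re_inner_nonneg x := by
    classical
    exact (tr_star_mul_self (stdOrthonormalBasis ℝ W) Finset.univ x (by rw [sub_univ]; trivial)).1
  add_left x y z := by simp [add_mul]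
  smul_left x y r := by simp [star_smul']
  definite x h := by
    classical
    exact (tr_star_mul_self (stdOrthonormalBasis ℝ W) Finset.univ x (by rw [sub_univ]; trivial)).2 h

noncomputable instance : NormedAddCommGroup (Cl W) := innerCore.toNormedAddCommGroup

noncomputable instance : InnerProductSpace ℝ (Cl W) := InnerProductSpace.ofCore innerCore.toCore

theorem inner_def (x y : Cl W) : inner ℝ x y = tr (star x * y) := rfl

/-- The isometric embedding of Clifford algebras induced by a linear isometry. -/
noncomputable def mapₗᵢ (f : W →ₗᵢ[ℝ] W') : Cl W →ₗᵢ[ℝ] Cl W' :=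
  (map f).toLinearMap.isometryOfInner fun x y => by
    change tr (star (map f x) * map f y) = tr (star x * y)
    rw [← map_star, ← map_mul, tr_map]

end Cl

end Clifford

/-! ### The fibre `M_N(ℂ) ⊗ Cl(W)` -/

section Fibre

open scoped TensorProduct

/-- `M_N(ℂ)` with the Hilbert-Schmidt inner product, as the space of matrix entries. -/
abbrev MatSpace (N : ℕ) : Type := EuclideanSpace ℂ (Fin N × Fin N)

/-- Left multiplication by a matrix on `M_N(ℂ)`. -/
noncomputable def matMul {N : ℕ} (A : Matrix (Fin N) (Fin N) ℂ) : MatSpace N →ₗ[ℂ] MatSpace N where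
  toFun X := WithLp.toLp 2 fun p => ∑ l, A p.1 l * X (l, p.2)
  map_add' X Y := by
    ext p; simp [mul_add, Finset.sum_add_distrib]
  map_smul' c X := by
    ext p; simp only [PiLp.smul_apply, smul_eq_mul, RingHom.id_apply, Finset.mul_sum]
    exact Finset.sum_congr rfl fun l _ => by ring

theorem matMul_norm {N : ℕ} {U : Matrix (Fin N) (Fin N) ℂ}
    (hU : U ∈ Matrix.unitaryGroup (Fin N) ℂ) (X : MatSpace N) : ‖matMul U X‖ = ‖X‖ := by
  have hU' := Matrix.mem_unitaryGroup_iff'.1 hU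
  have key : ∀ j : Fin N, ∑ i, ‖∑ l, U i l * X (l, j)‖ ^ 2 = ∑ l, ‖X (l, j)‖ ^ 2 := by
    intro j
    have h0 : ∀ v : Fin N → ℂ, ((∑ i, ‖v i‖ ^ 2 : ℝ) : ℂ) = star v ⬝ᵥ v := by
      intro v
      simp only [dotProduct, Pi.star_apply, Complex.ofReal_sum]
      refine Finset.sum_congr rfl fun i _ => ?_
      rw [RCLike.star_def, RCLike.conj_mul]; simp
    have h1 := h0 (U.mulVec fun l => X (l, j))
    rw [Matrix.star_mulVec, ← Matrix.dotProduct_mulVec, Matrix.mulVec_mulVec,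
      ← Matrix.star_eq_conjTranspose, hU', Matrix.one_mulVec, ← h0] at h1
    exact_mod_cast h1
  have h2 : ‖matMul U X‖ ^ 2 = ‖X‖ ^ 2 := by
    rw [EuclideanSpace.norm_sq_eq, EuclideanSpace.norm_sq_eq, Fintype.sum_prod_type_right,
      Fintype.sum_prod_type_right]
    exact Finset.sum_congr rfl fun j _ => key j
  exact (sq_eq_sq₀ (norm_nonneg _) (norm_nonneg _)).1 h2

variable (N : ℕ) (W : Type*) [NormedAddCommGroup W] [InnerProductSpace ℝ W]

/-- The fibre `M_N(ℂ) ⊗ Cl(W)` of the bundle on whose sections the Dirac operator acts. -/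
def Fib : Type _ := MatSpace N ⊗[ℝ] Cl W

variable [FiniteDimensional ℝ W]

noncomputable instance : NormedAddCommGroup (Fib N W) :=
  inferInstanceAs (NormedAddCommGroup (MatSpace N ⊗[ℝ] Cl W))
noncomputable instance : InnerProductSpace ℝ (Fib N W) :=
  inferInstanceAs (InnerProductSpace ℝ (MatSpace N ⊗[ℝ] Cl W))
instance : FiniteDimensional ℝ (Fib N W) :=
  inferInstanceAs (FiniteDimensional ℝ (MatSpace N ⊗[ℝ] Cl W))
noncomputable instance : Module ℂ (Fib N W) :=
  inferInstanceAs (Module ℂ (MatSpace N ⊗[ℝ] Cl W))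
instance : IsScalarTower ℝ ℂ (Fib N W) :=
  inferInstanceAs (IsScalarTower ℝ ℂ (MatSpace N ⊗[ℝ] Cl W))

namespace Fib

variable {N W}

theorem inner_I_smul (x y : Fib N W) :
    inner ℝ (Complex.I • x) (Complex.I • y) = inner ℝ x y := by
  let J : MatSpace N →ₗᵢ[ℝ] MatSpace N :=
    { toFun := fun X => Complex.I • X
      map_add' := fun X Y => smul_add _ _ _
      map_smul' := fun r X => smul_comm _ _ _
      norm_map' := fun X => by simp [norm_smul] }
  have h : ∀ z : MatSpace N ⊗[ℝ] Cl W,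
      Complex.I • z = TensorProduct.map J.toLinearMap (LinearIsometry.id (R := ℝ) (E := Cl W)).toLinearMap z := by
    intro z
    induction z using TensorProduct.induction_on with
    | zero => simp
    | tmul a b => simp [TensorProduct.smul_tmul', J]
    | add a b ha hb => rw [smul_add, ha, hb, map_add]
  exact (congrArg₂ (fun a b : MatSpace N ⊗[ℝ] Cl W => inner ℝ a b) (h x) (h y)).trans
    (TensorProduct.inner_map_map J LinearIsometry.id x y)

theorem I_smul_I_smul (x : Fib N W) : Complex.I • Complex.I • x = -x := by
  rw [smul_smul, Complex.I_mul_I, neg_one_smul]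

theorem inner_I_smul_left (x y : Fib N W) :
    inner ℝ (Complex.I • x) y = -inner ℝ x (Complex.I • y) := by
  have h := inner_I_smul x (Complex.I • y)
  rw [I_smul_I_smul, inner_neg_right] at h
  linarith

theorem smul_eq (z : ℂ) (x : Fib N W) : z • x = z.re • x + z.im • (Complex.I • x) := by
  conv_lhs => rw [← Complex.re_add_im z, add_smul]
  rw [← smul_assoc z.im, ← algebraMap_smul ℂ z.re x]
  simp

theorem norm_complex_smul (z : ℂ) (x : Fib N W) : ‖z • x‖ = ‖z‖ * ‖x‖ := by
  have h0 : inner ℝ x (Complex.I • x) = 0 := by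
    have := inner_I_smul_left x x
    rw [real_inner_comm] at this; linarith
  have hI : ‖Complex.I • x‖ ^ 2 = ‖x‖ ^ 2 := by
    rw [← real_inner_self_eq_norm_sq, inner_I_smul, real_inner_self_eq_norm_sq]
  have : ‖z • x‖ ^ 2 = (‖z‖ * ‖x‖) ^ 2 := by
    rw [smul_eq, norm_add_sq_real, inner_smul_left, inner_smul_right, h0, norm_smul, norm_smul,
      mul_pow, mul_pow, mul_pow, hI, ← Complex.normSq_eq_norm_sq, Complex.normSq_apply]
    simp; ring
  exact (sq_eq_sq₀ (norm_nonneg _) (by positivity)).1 this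

/-- The complex inner product on `M_N(ℂ) ⊗ Cl(W)`; its real part is the tensor product of the real
inner products of `M_N(ℂ)` and `Cl(W)`, so that `⟪A ⊗ x, B ⊗ y⟫ = tr(A⋆ B) ⟪x, y⟫`. -/
noncomputable instance : InnerProductSpace ℂ (Fib N W) where
  norm_smul_le z x := (norm_complex_smul z x).le
  inner x y := (inner ℝ x y : ℂ) + Complex.I * (inner ℝ (Complex.I • x) y : ℂ)
  norm_sq_eq_re_inner x := by simp [-Complex.ofReal_pow]
  conj_inner_symm x y := by
    rw [inner_I_smul_left y x, real_inner_comm x y, real_inner_comm (Complex.I • x) y]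
    simp
  add_left x y z := by
    rw [smul_add, inner_add_left, inner_add_left]; push_cast; ring
  smul_left x y z := by
    have h1 : Complex.I • z • x = z.re • (Complex.I • x) - z.im • x := by
      rw [smul_eq z x, smul_add, smul_comm Complex.I z.re, smul_comm Complex.I z.im, I_smul_I_smul,
        smul_neg, sub_eq_add_neg]
    rw [h1, smul_eq z x, inner_add_left, inner_sub_left]
    simp only [inner_smul_left]
    apply Complex.ext
    · simp
    · simp; ring

theorem inner_tmul (A B : MatSpace N) (x y : Cl W) :
    inner ℂ (show Fib N W from A ⊗ₜ x) (show Fib N W from B ⊗ₜ y) = inner ℂ A B * (inner ℝ x y : ℂ) := by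
  have h : ∀ A : MatSpace N, inner ℝ (show Fib N W from A ⊗ₜ x) (show Fib N W from B ⊗ₜ y)
      = inner ℝ A B * inner ℝ x y := fun A => TensorProduct.inner_tmul ℝ A B x y
  change ((inner ℝ (show Fib N W from A ⊗ₜ x) (show Fib N W from B ⊗ₜ y) : ℝ) : ℂ)
    + Complex.I * ((inner ℝ (show Fib N W from (Complex.I • A) ⊗ₜ x) (show Fib N W from B ⊗ₜ y) : ℝ) : ℂ) = _
  rw [h, h]
  have e1 : ∀ A : MatSpace N, inner ℝ A B = (inner ℂ A B).re := by
    intro A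
    simp only [PiLp.inner_apply, Complex.re_sum]
    rfl
  rw [e1, e1, inner_smul_left]
  apply Complex.ext <;> simp

/-- The action of a matrix, by left multiplication on the factor `M_N(ℂ)`. -/
noncomputable def matAct (A : Matrix (Fin N) (Fin N) ℂ) : Fib N W →ₗ[ℂ] Fib N W :=
  TensorProduct.AlgebraTensorModule.map (matMul A) (LinearMap.id (R := ℝ) (M := Cl W))

/-- Clifford multiplication by a vector, on the factor `Cl(W)`. -/
noncomputable def cliffAct (w : W) : Fib N W →ₗ[ℂ] Fib N W :=
  TensorProduct.AlgebraTensorModule.map (LinearMap.id (R := ℂ) (M := MatSpace N))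
    (LinearMap.mulLeft ℝ (Cl.vec w))

theorem matAct_norm {U : Matrix (Fin N) (Fin N) ℂ} (hU : U ∈ Matrix.unitaryGroup (Fin N) ℂ)
    (x : Fib N W) : ‖matAct U x‖ = ‖x‖ := by
  let J : MatSpace N →ₗᵢ[ℝ] MatSpace N :=
    { toLinearMap := (matMul U).restrictScalars ℝ
      norm_map' := fun X => matMul_norm hU X }
  exact TensorProduct.norm_map J (LinearIsometry.id (R := ℝ) (E := Cl W)) x

theorem matAct_add (A B : Matrix (Fin N) (Fin N) ℂ) (x : Fib N W) :
    matAct (A + B) x = matAct A x + matAct B x := by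
  have h : matMul (A + B) = matMul A + matMul B := by
    ext X p
    simp [matMul, add_mul, Finset.sum_add_distrib]
  simp only [matAct, h]
  rw [TensorProduct.AlgebraTensorModule.map_add_left]; rfl

theorem matAct_smul (c : ℂ) (A : Matrix (Fin N) (Fin N) ℂ) (x : Fib N W) :
    matAct (c • A) x = c • matAct A x := by
  have h : matMul (c • A) = c • matMul A := by
    ext X p
    simp [matMul, Finset.mul_sum, mul_assoc]
  simp only [matAct, h]
  rw [TensorProduct.AlgebraTensorModule.map_smul_left]; rfl

instance : FiniteDimensional ℂ (Fib N W) := Module.Finite.of_restrictScalars_finite ℝ ℂ (Fib N W)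

/-- The action of matrices on the fibre as a continuous linear map. -/
noncomputable def matActL : Matrix (Fin N) (Fin N) ℂ →ₗ[ℂ] (Fib N W →L[ℂ] Fib N W) where
  toFun A := (matAct A).toContinuousLinearMap
  map_add' A B := by ext x; exact matAct_add A B x
  map_smul' c A := by ext x; exact matAct_smul c A x

theorem continuous_matActL : Continuous (matActL : Matrix (Fin N) (Fin N) ℂ → (Fib N W →L[ℂ] Fib N W)) :=
  LinearMap.continuous_of_finiteDimensional _

variable {W' : Type*} [NormedAddCommGroup W'] [InnerProductSpace ℝ W'] [FiniteDimensional ℝ W']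

/-- The isometric embedding of fibres induced by a linear isometry. -/
noncomputable def map (f : W →ₗᵢ[ℝ] W') : Fib N W →ₗᵢ[ℂ] Fib N W' where
  toLinearMap := TensorProduct.AlgebraTensorModule.map (LinearMap.id (R := ℂ) (M := MatSpace N))
    (Cl.mapₗᵢ f).toLinearMap
  norm_map' x := TensorProduct.norm_map (LinearIsometry.id (R := ℝ) (E := MatSpace N)) (Cl.mapₗᵢ f) x

theorem map_matAct (f : W →ₗᵢ[ℝ] W') (A : Matrix (Fin N) (Fin N) ℂ) (x : Fib N W) :
    map f (matAct A x) = matAct A (map f x) := by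
  have h : ((map f : Fib N W →ₗᵢ[ℂ] Fib N W').toLinearMap ∘ₗ matAct A : Fib N W →ₗ[ℂ] Fib N W')
      = matAct A ∘ₗ (map f).toLinearMap := by
    refine TensorProduct.AlgebraTensorModule.ext (R := ℝ) (A := ℂ) (M := MatSpace N) (N := Cl W)
      (P := Fib N W') fun a b => rfl
  exact LinearMap.congr_fun h x

end Fib

end Fibre

/-! ### Direct limits of Hilbert spaces -/

section HilbertLimit

open Filter

variable {H : ℕ → Type*} [∀ n, NormedAddCommGroup (H n)] [∀ n, InnerProductSpace ℂ (H n)]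

/-- The algebraic direct limit, before identifying sequences that agree from some index on:
sequences that are from some index on transported by the structure maps. -/
def evCoherent (J : ∀ n, H n →ₗᵢ[ℂ] H (n + 1)) : Submodule ℂ (∀ n, H n) where
  carrier := {x | ∃ m, ∀ n, m ≤ n → x (n + 1) = J n (x n)}
  add_mem' := by
    rintro x y ⟨m, hx⟩ ⟨m', hy⟩
    refine ⟨max m m', fun n hn => ?_⟩
    simp [hx n (le_of_max_le_left hn), hy n (le_of_max_le_right hn)]
  zero_mem' := ⟨0, fun n _ => by simp⟩
  smul_mem' := by
    rintro c x ⟨m, hx⟩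
    exact ⟨m, fun n hn => by simp [hx n hn]⟩

/-- The algebraic direct limit, with the topology of its inner product (below). -/
def EvCoherent (J : ∀ n, H n →ₗᵢ[ℂ] H (n + 1)) : Type _ := evCoherent J

namespace EvCoherent

variable {J : ∀ n, H n →ₗᵢ[ℂ] H (n + 1)}

noncomputable instance : AddCommGroup (EvCoherent J) := inferInstanceAs (AddCommGroup (evCoherent J))
noncomputable instance : Module ℂ (EvCoherent J) := inferInstanceAs (Module ℂ (evCoherent J))

theorem inner_const {x y : ∀ n, H n} {m : ℕ} (hx : ∀ n, m ≤ n → x (n + 1) = J n (x n))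
    (hy : ∀ n, m ≤ n → y (n + 1) = J n (y n)) (n : ℕ) (hn : m ≤ n) :
    inner ℂ (x n) (y n) = inner ℂ (x m) (y m) := by
  induction n, hn using Nat.le_induction with
  | base => rfl
  | succ n hn ih => rw [hx n hn, hy n hn, LinearIsometry.inner_map_map, ih]

/-- The inner product `lim ⟪x n, y n⟫` of eventually constant sequences. -/
noncomputable def limInner (x y : EvCoherent J) : ℂ :=
  limUnder atTop fun n => inner ℂ (x.1 n) (y.1 n)

theorem limInner_spec (x y : EvCoherent J) :
    ∃ m, ∀ n, m ≤ n → limInner x y = inner ℂ (x.1 n) (y.1 n) := by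
  obtain ⟨m, hx⟩ := x.2
  obtain ⟨m', hy⟩ := y.2
  have h := inner_const (fun n hn => hx n (le_of_max_le_left hn))
    (fun n hn => hy n (le_of_max_le_right hn))
  refine ⟨max m m', fun n hn => ?_⟩
  rw [h n hn]
  exact (tendsto_const_nhds.congr' ((eventually_ge_atTop (max m m')).mono
    fun k hk => (h k hk).symm)).limUnder_eq

@[reducible]
noncomputable def core (J : ∀ n, H n →ₗᵢ[ℂ] H (n + 1)) :
    PreInnerProductSpace.Core ℂ (EvCoherent J) where
  inner := limInner
  conj_inner_symm x y := by
    obtain ⟨m, h⟩ := limInner_spec x y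
    obtain ⟨m', h'⟩ := limInner_spec y x
    rw [h _ (le_max_left m m'), h' _ (le_max_right m m')]
    exact inner_conj_symm _ _
  re_inner_nonneg x := by
    obtain ⟨m, h⟩ := limInner_spec x x
    rw [h _ le_rfl]
    exact inner_self_nonneg
  add_left x y z := by
    obtain ⟨m, h⟩ := limInner_spec (x + y) z
    obtain ⟨m', h'⟩ := limInner_spec x z
    obtain ⟨m'', h''⟩ := limInner_spec y z
    rw [h (m + m' + m'') (by omega), h' (m + m' + m'') (by omega), h'' (m + m' + m'') (by omega)]
    exact inner_add_left _ _ _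
  smul_left x y r := by
    obtain ⟨m, h⟩ := limInner_spec (r • x) y
    obtain ⟨m', h'⟩ := limInner_spec x y
    rw [h (m + m') (by omega), h' (m + m') (by omega)]
    exact inner_smul_left _ _ _

noncomputable instance : SeminormedAddCommGroup (EvCoherent J) :=
  letI := core J
  InnerProductSpace.Core.toSeminormedAddCommGroup (𝕜 := ℂ)

noncomputable instance : InnerProductSpace ℂ (EvCoherent J) := InnerProductSpace.ofCore (core J)

theorem norm_spec (x : EvCoherent J) : ∃ m, ∀ n, m ≤ n → ‖x‖ = ‖x.1 n‖ := by
  obtain ⟨m, h⟩ := limInner_spec x x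
  refine ⟨m, fun n hn => ?_⟩
  have h1 : inner ℂ x x = inner ℂ (x.1 n) (x.1 n) := h n hn
  rw [← sq_eq_sq₀ (norm_nonneg _) (norm_nonneg _), ← inner_self_eq_norm_sq (𝕜 := ℂ), h1,
    inner_self_eq_norm_sq]

end EvCoherent

variable (J : ∀ n, H n →ₗᵢ[ℂ] H (n + 1))

/-- The Hilbert space direct limit of `H 0 → H 1 → H 2 → ⋯`: the (separated) completion of the
algebraic direct limit. -/
abbrev HilbertLim : Type _ := UniformSpace.Completion (EvCoherent J)

namespace HilbertLim

/-- The image of `x : H n` under the structure maps, placed at the indices `k ≥ n`. -/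
noncomputable def push (n : ℕ) (x : H n) (k : ℕ) : H k :=
  if h : n ≤ k then Nat.leRec (motive := fun m _ => H m) x (fun m _ y => J m y) h else 0

theorem push_self (n : ℕ) (x : H n) : push J n x n = x := by simp [push]

theorem push_succ {n : ℕ} (x : H n) {k : ℕ} (h : n ≤ k) :
    push J n x (k + 1) = J k (push J n x k) := by
  simp [push, h, Nat.le_succ_of_le h, Nat.leRec_succ]

theorem push_add (n : ℕ) (x y : H n) (k : ℕ) : push J n (x + y) k = push J n x k + push J n y k := by
  by_cases h : n ≤ k
  · induction k, h using Nat.le_induction with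
    | base => simp [push_self]
    | succ k hk ih => simp [push_succ J _ hk, ih]
  · simp [push, h]

theorem push_smul (n : ℕ) (c : ℂ) (x : H n) (k : ℕ) : push J n (c • x) k = c • push J n x k := by
  by_cases h : n ≤ k
  · induction k, h using Nat.le_induction with
    | base => simp [push_self]
    | succ k hk ih => simp [push_succ J _ hk, ih]
  · simp [push, h]

theorem norm_push {n : ℕ} (x : H n) {k : ℕ} (h : n ≤ k) : ‖push J n x k‖ = ‖x‖ := by
  induction k, h using Nat.le_induction with
  | base => simp [push_self]
  | succ k hk ih => simp [push_succ J _ hk, ih]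

/-- The canonical isometric embedding of `H n` into the algebraic direct limit. -/
noncomputable def ofAux (n : ℕ) : H n →ₗᵢ[ℂ] EvCoherent J where
  toFun x := ⟨push J n x, n, fun _ hk => push_succ J x hk⟩
  map_add' x y := Subtype.ext (funext fun k => push_add J n x y k)
  map_smul' c x := Subtype.ext (funext fun k => push_smul J n c x k)
  norm_map' x := by
    obtain ⟨m, h⟩ := EvCoherent.norm_spec
      (⟨push J n x, n, fun _ hk => push_succ J x hk⟩ : EvCoherent J)
    exact (h _ (le_max_left m n)).trans (norm_push J x (le_max_right m n))

/-- The canonical isometric embedding of `H n` into the Hilbert space direct limit. -/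
noncomputable def of (n : ℕ) : H n →ₗᵢ[ℂ] HilbertLim J :=
  UniformSpace.Completion.toComplₗᵢ.comp (ofAux J n)

/-- The operator `(x k) ↦ (T k (x k))` on the algebraic direct limit. -/
noncomputable def liftAux (m : ℕ) (T : ∀ k, H k →ₗᵢ[ℂ] H k)
    (hT : ∀ k, m ≤ k → ∀ x, T (k + 1) (J k x) = J k (T k x)) : EvCoherent J →ₗᵢ[ℂ] EvCoherent J :=
  have h : ∀ x : EvCoherent J, (fun k => T k (x.1 k)) ∈ evCoherent J := by
    rintro ⟨x, m', hx⟩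
    refine ⟨max m m', fun n hn => ?_⟩
    change T (n + 1) (x (n + 1)) = J n (T n (x n))
    rw [hx n (le_of_max_le_right hn), hT n (le_of_max_le_left hn)]
  { toFun := fun x => ⟨fun k => T k (x.1 k), h x⟩
    map_add' := fun x y => Subtype.ext (funext fun k => map_add (T k) _ _)
    map_smul' := fun c x => Subtype.ext (funext fun k => map_smul (T k) _ _)
    norm_map' := fun x => by
      obtain ⟨m', hx⟩ := EvCoherent.norm_spec x
      obtain ⟨m'', hy⟩ := EvCoherent.norm_spec (⟨fun k => T k (x.1 k), h x⟩ : EvCoherent J)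
      rw [hx _ (le_max_left m' m'')]
      exact (hy _ (le_max_right m' m'')).trans ((T _).norm_map _) }

/-- The bounded operator on the direct limit induced by isometries `T k` of the spaces `H k` that
are compatible with the structure maps from the index `m` on. -/
noncomputable def lift (m : ℕ) (T : ∀ k, H k →ₗᵢ[ℂ] H k)
    (hT : ∀ k, m ≤ k → ∀ x, T (k + 1) (J k x) = J k (T k x)) :
    HilbertLim J →L[ℂ] HilbertLim J :=
  (UniformSpace.Completion.toComplL.comp (liftAux J m T hT).toContinuousLinearMap).extend
    UniformSpace.Completion.toComplL

theorem lift_of (m : ℕ) (T : ∀ k, H k →ₗᵢ[ℂ] H k)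
    (hT : ∀ k, m ≤ k → ∀ x, T (k + 1) (J k x) = J k (T k x)) {k : ℕ} (hk : m ≤ k) (x : H k) :
    lift J m T hT (of J k x) = of J k (T k x) := by
  have hp : ∀ j, T j (push J k x j) = push J k (T k x) j := by
    intro j
    by_cases hj : k ≤ j
    · induction j, hj using Nat.le_induction with
      | base => simp [push_self]
      | succ j hj ih => rw [push_succ J _ hj, push_succ J _ hj, hT j (hk.trans hj), ih]
    · simp [push, hj]
  refine (ContinuousLinearMap.extend_eq (e := UniformSpace.Completion.toComplL) _
    UniformSpace.Completion.denseRange_coe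
    (UniformSpace.Completion.isUniformInducing_coe (EvCoherent J)) (ofAux J k x)).trans ?_
  exact congrArg (fun y : EvCoherent J => (y : HilbertLim J)) (Subtype.ext (funext hp))

end HilbertLim

end HilbertLimit

/-! ### Nested graphs, generalized connections and the coordinate change -/

/-- A nested sequence `S 0 ⊂ S 1 ⊂ ⋯` of finite oriented graphs with vertices in `V`. Passing from
`S n` to `S (n + 1)` every edge `e` is subdivided into two edges `fst e`, `snd e` (traversed in this
order, orientations being preserved), and new edges may be added. -/
structure GraphSystem (V : Type*) where
  Edge : ℕ → Type*
  [fintype : ∀ n, Fintype (Edge n)]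
  src {n : ℕ} : Edge n → V
  tgt {n : ℕ} : Edge n → V
  fst {n : ℕ} : Edge n → Edge (n + 1)
  snd {n : ℕ} : Edge n → Edge (n + 1)
  src_fst {n : ℕ} (e : Edge n) : src (fst e) = src e
  tgt_fst {n : ℕ} (e : Edge n) : tgt (fst e) = src (snd e)
  tgt_snd {n : ℕ} (e : Edge n) : tgt (snd e) = tgt e
  fst_inj {n : ℕ} : Function.Injective (fst (n := n))
  snd_inj {n : ℕ} : Function.Injective (snd (n := n))
  fst_ne_snd {n : ℕ} (e e' : Edge n) : fst e ≠ snd e'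

attribute [instance] GraphSystem.fintype

namespace GraphSystem

variable {V : Type*} (S : GraphSystem V)

open scoped Classical in
/-- The list of the edges of `S n` that make up the remaining part, from `e` on, of the edge of the
first graph in which the curve carrying `e` occurs: `e` itself comes first. -/
noncomputable def tail : ∀ n, S.Edge n → List (S.Edge n)
  | 0, e => [e]
  | n + 1, e =>
    if h : ∃ d, S.fst d = e then (tail n h.choose).flatMap fun d => [S.fst d, S.snd d]
    else if h : ∃ d, S.snd d = e then
      ((tail n h.choose).flatMap fun d => [S.fst d, S.snd d]).tail
    else [e]

open scoped Classical in
/-- The edge of `S n` that follows `e` inside the edge of the first graph in which the curve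
carrying `e` occurs, if there is one. -/
noncomputable def next : ∀ n, S.Edge n → Option (S.Edge n)
  | 0, _ => none
  | n + 1, e =>
    if h : ∃ d, S.fst d = e then some (S.snd h.choose)
    else if h : ∃ d, S.snd d = e then (next n h.choose).map S.fst
    else none

section Lemmas

variable {n : ℕ}

theorem tail_fst (d : S.Edge n) :
    S.tail (n + 1) (S.fst d) = (S.tail n d).flatMap fun d => [S.fst d, S.snd d] := by
  have h : ∃ d', S.fst d' = S.fst d := ⟨d, rfl⟩
  have h2 : h.choose = d := S.fst_inj h.choose_spec
  rw [tail, dif_pos h, h2]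

theorem tail_snd (d : S.Edge n) :
    S.tail (n + 1) (S.snd d) = ((S.tail n d).flatMap fun d => [S.fst d, S.snd d]).tail := by
  have h0 : ¬ ∃ d', S.fst d' = S.snd d := fun ⟨d', h⟩ => S.fst_ne_snd _ _ h
  have h : ∃ d', S.snd d' = S.snd d := ⟨d, rfl⟩
  have h2 : h.choose = d := S.snd_inj h.choose_spec
  rw [tail, dif_neg h0, dif_pos h, h2]

theorem next_fst (d : S.Edge n) : S.next (n + 1) (S.fst d) = some (S.snd d) := by
  have h : ∃ d', S.fst d' = S.fst d := ⟨d, rfl⟩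
  have h2 : h.choose = d := S.fst_inj h.choose_spec
  rw [next, dif_pos h, h2]

theorem next_snd (d : S.Edge n) : S.next (n + 1) (S.snd d) = (S.next n d).map S.fst := by
  have h0 : ¬ ∃ d', S.fst d' = S.snd d := fun ⟨d', h⟩ => S.fst_ne_snd _ _ h
  have h : ∃ d', S.snd d' = S.snd d := ⟨d, rfl⟩
  have h2 : h.choose = d := S.snd_inj h.choose_spec
  rw [next, dif_neg h0, dif_pos h, h2]

theorem tail_eq (n : ℕ) (e : S.Edge n) :
    S.tail n e = e :: ((S.next n e).elim [] (S.tail n)) := by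
  induction n with
  | zero => rfl
  | succ n ih =>
    by_cases h : ∃ d, S.fst d = e
    · obtain ⟨d, rfl⟩ := h
      rw [next_fst, Option.elim_some, tail_fst, tail_snd, ih d]
      simp
    · by_cases h' : ∃ d, S.snd d = e
      · obtain ⟨d, rfl⟩ := h'
        rw [next_snd, tail_snd, ih d]
        cases S.next n d with
        | none => simp
        | some d' => simp [tail_fst]
      · rw [tail, dif_neg h, dif_neg h', next, dif_neg h, dif_neg h']
        rfl

end Lemmas

variable {G : Type*} [Group G]

/-- The coordinate change `Θ`: the coordinate of the edge `e` is the holonomy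
`g e * g e' * g e'' * ⋯` along `e` and the edges following it. -/
noncomputable def theta (n : ℕ) (g : S.Edge n → G) (e : S.Edge n) : G := ((S.tail n e).map g).prod

/-- The inverse coordinate change: `g e * (g e')⁻¹` with `e'` the edge following `e`, and `g e` if
there is no such edge. -/
noncomputable def thetaInv (n : ℕ) (g : S.Edge n → G) (e : S.Edge n) : G :=
  (S.next n e).elim (g e) fun e' => g e * (g e')⁻¹

theorem theta_eq (n : ℕ) (g : S.Edge n → G) (e : S.Edge n) :
    S.theta n g e = g e * (S.next n e).elim 1 (S.theta n g) := by
  rw [theta, tail_eq]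
  cases S.next n e <;> simp [theta]

theorem thetaInv_theta (n : ℕ) (g : S.Edge n → G) : S.thetaInv n (S.theta n g) = g := by
  funext e
  rw [thetaInv]
  have h := S.theta_eq n g e
  cases hn : S.next n e with
  | none => simpa [hn] using h
  | some e' =>
    rw [hn] at h
    simp only [Option.elim_some] at h ⊢
    rw [h, mul_inv_cancel_right]

theorem theta_thetaInv (n : ℕ) (g : S.Edge n → G) : S.theta n (S.thetaInv n g) = g := by
  have key : ∀ m, ∀ e : S.Edge n, (S.tail n e).length ≤ m → S.theta n (S.thetaInv n g) e = g e := by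
    intro m
    induction m with
    | zero => intro e he; rw [tail_eq] at he; simp at he
    | succ m ih =>
      intro e he
      rw [theta_eq, thetaInv]
      rw [tail_eq] at he
      cases hn : S.next n e with
      | none => simp
      | some e' =>
        rw [hn] at he
        simp only [Option.elim_some, List.length_cons] at he ⊢
        rw [ih e' (by omega), inv_mul_cancel_right]
  exact funext fun e => key _ e le_rfl

/-- The structure map `𝒜 (n + 1) → 𝒜 n`: the holonomy along `e` is the product of the holonomies
along its two halves, and the new edges are forgotten. -/
def proj (n : ℕ) (g : S.Edge (n + 1) → G) (e : S.Edge n) : G := g (S.fst e) * g (S.snd e)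

/-- In the new coordinates the structure maps delete copies of `G`. -/
theorem theta_proj (n : ℕ) (g : S.Edge (n + 1) → G) (e : S.Edge n) :
    S.theta n (S.proj n g) e = S.theta (n + 1) g (S.fst e) := by
  rw [theta, theta, tail_fst]
  induction S.tail n e with
  | nil => rfl
  | cons d l ih => simp [ih, proj, mul_assoc]

variable (G) in
/-- The completed space of connections: the projective limit of the spaces `𝒜 n = G ^ Edge n`. -/
def Connections : Type _ := {A : ∀ n, S.Edge n → G // ∀ n, S.proj n (A (n + 1)) = A n}

/-- The embedding of the set of edges of `S n` into that of `S k` for `n ≤ k` which carries the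
labels of the coordinates of `𝒜 n` to those of the same coordinates in `𝒜 k`. -/
def incl {n k : ℕ} (h : n ≤ k) (e : S.Edge n) : S.Edge k := Nat.leRecOn h (fun d => S.fst d) e

theorem incl_self {n : ℕ} (e : S.Edge n) : S.incl le_rfl e = e := Nat.leRecOn_self _

theorem incl_succ {n k : ℕ} (h : n ≤ k) (e : S.Edge n) :
    S.incl (Nat.le_succ_of_le h) e = S.fst (S.incl h e) := Nat.leRecOn_succ h _

theorem incl_fst {n k : ℕ} (h : n + 1 ≤ k) (e : S.Edge n) :
    S.incl h (S.fst e) = S.incl (Nat.le_of_succ_le h) e := by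
  induction k, h using Nat.le_induction with
  | base => rw [incl_self, S.incl_succ le_rfl, incl_self]
  | succ k h ih => rw [S.incl_succ h, ih, ← S.incl_succ]

theorem theta_incl (A : S.Connections G) {n k : ℕ} (h : n ≤ k) (e : S.Edge n) :
    S.theta k (A.1 k) (S.incl h e) = S.theta n (A.1 n) e := by
  induction k, h using Nat.le_induction with
  | base => rw [incl_self]
  | succ k h ih => rw [S.incl_succ h, ← theta_proj, A.2 k, ih]

/-! ### Loops and holonomies -/

/-- The starting point of an edge with a direction (`true` for the direction of the edge). -/
def start {n : ℕ} (s : S.Edge n × Bool) : V := if s.2 then S.src s.1 else S.tgt s.1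

/-- The end point of an edge with a direction. -/
def finish {n : ℕ} (s : S.Edge n × Bool) : V := if s.2 then S.tgt s.1 else S.src s.1

/-- `l` is a path from `v` to `w`. -/
def IsPath {n : ℕ} (v w : V) : List (S.Edge n × Bool) → Prop
  | [] => v = w
  | s :: l => S.start s = v ∧ IsPath (S.finish s) w l

/-- A loop in the system with base point `v`: a closed path of edges, and edges with reversed
direction, in one of the graphs. -/
structure Loop (v : V) where
  level : ℕ
  path : List (S.Edge level × Bool)
  isPath : S.IsPath v v path

variable {S}

/-- The holonomy along a path of a connection, given by its holonomies along the edges. -/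
def pathHol {n : ℕ} (g : S.Edge n → G) (l : List (S.Edge n × Bool)) : G :=
  (l.map fun s => if s.2 then g s.1 else (g s.1)⁻¹).prod

/-- The holonomy of a loop, as a function on the completed space of connections. -/
def Loop.hol {v : V} (L : S.Loop v) (A : S.Connections G) : G := pathHol (A.1 L.level) L.path

/-- The holonomy of a loop of level `n`, in the new coordinates of `𝒜 k`, `n ≤ k`. -/
noncomputable def Loop.holCoord {v : V} (L : S.Loop v) {k : ℕ} (h : L.level ≤ k)
    (g : S.Edge k → G) : G :=
  pathHol (S.thetaInv L.level fun e => g (S.incl h e)) L.path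

theorem Loop.holCoord_theta {v : V} (L : S.Loop v) {k : ℕ} (h : L.level ≤ k)
    (A : S.Connections G) : L.holCoord h (S.theta k (A.1 k)) = L.hol A := by
  have : (fun e => S.theta k (A.1 k) (S.incl h e)) = S.theta L.level (A.1 L.level) :=
    funext fun e => S.theta_incl A h e
  rw [holCoord, this, thetaInv_theta, hol]

end GraphSystem
/-! ### Isometries between `L²` spaces -/

section LpIsometries

open MeasureTheory

variable {X : Type*} [MeasurableSpace X] (μ : Measure X)
  {F : Type*} [NormedAddCommGroup F] [InnerProductSpace ℂ F]
  {F' : Type*} [NormedAddCommGroup F'] [InnerProductSpace ℂ F']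

/-- Pointwise application of a linear isometry. -/
noncomputable def compLp (T : F →ₗᵢ[ℂ] F') : Lp F 2 μ →ₗᵢ[ℂ] Lp F' 2 μ where
  toLinearMap := T.toContinuousLinearMap.compLpₗ 2 μ
  norm_map' f := by
    rw [Lp.norm_def, Lp.norm_def]
    congr 1
    refine eLpNorm_congr_norm_ae ?_
    filter_upwards [ContinuousLinearMap.coeFn_compLp T.toContinuousLinearMap f] with x hx
    rw [ContinuousLinearMap.compLpₗ_apply, hx]
    exact LinearIsometry.norm_map _ _

theorem compLp_coe (T : F →ₗᵢ[ℂ] F') (f : Lp F 2 μ) : compLp μ T f =ᵐ[μ] fun x => T (f x) :=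
  ContinuousLinearMap.coeFn_compLp T.toContinuousLinearMap f

theorem mulLp_memLp (U : X → F →L[ℂ] F) (hU : AEStronglyMeasurable U μ)
    (hn : ∀ x y, ‖U x y‖ = ‖y‖) (f : Lp F 2 μ) : MemLp (fun x => U x (f x)) 2 μ :=
  (Lp.memLp f).of_le
    ((ContinuousLinearMap.apply ℂ F).aestronglyMeasurable_comp₂ (Lp.aestronglyMeasurable f) hU)
    (Filter.Eventually.of_forall fun x => (hn x _).le)

/-- Pointwise application of a measurable family of isometries. -/
noncomputable def mulLp (U : X → F →L[ℂ] F) (hU : AEStronglyMeasurable U μ)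
    (hn : ∀ x y, ‖U x y‖ = ‖y‖) : Lp F 2 μ →ₗᵢ[ℂ] Lp F 2 μ where
  toFun f := (mulLp_memLp μ U hU hn f).toLp
  map_add' f f' := by
    ext1
    filter_upwards [(mulLp_memLp μ U hU hn (f + f')).coeFn_toLp,
      (mulLp_memLp μ U hU hn f).coeFn_toLp, (mulLp_memLp μ U hU hn f').coeFn_toLp,
      Lp.coeFn_add f f', Lp.coeFn_add (mulLp_memLp μ U hU hn f).toLp
      (mulLp_memLp μ U hU hn f').toLp] with g h1 h2 h3 h4 h5
    rw [h1, h5, Pi.add_apply, h2, h3, h4, Pi.add_apply, map_add]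
  map_smul' c f := by
    ext1
    filter_upwards [(mulLp_memLp μ U hU hn (c • f)).coeFn_toLp,
      (mulLp_memLp μ U hU hn f).coeFn_toLp,
      Lp.coeFn_smul c f, Lp.coeFn_smul c (mulLp_memLp μ U hU hn f).toLp] with g h1 h2 h4 h5
    rw [h1, RingHom.id_apply, h5, Pi.smul_apply, h2, h4, Pi.smul_apply, map_smul]
  norm_map' f := by
    change ‖(mulLp_memLp μ U hU hn f).toLp‖ = ‖f‖
    rw [Lp.norm_def, Lp.norm_def]
    congr 1
    refine eLpNorm_congr_norm_ae ?_
    filter_upwards [(mulLp_memLp μ U hU hn f).coeFn_toLp] with g hg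
    rw [hg, hn]

theorem mulLp_coe (U : X → F →L[ℂ] F) (hU : AEStronglyMeasurable U μ)
    (hn : ∀ x y, ‖U x y‖ = ‖y‖) (f : Lp F 2 μ) : mulLp μ U hU hn f =ᵐ[μ] fun x => U x (f x) :=
  (mulLp_memLp μ U hU hn f).coeFn_toLp

end LpIsometries

section Geometry

open MeasureTheory Manifold Bundle
open scoped ContDiff

variable {V : Type*} (S : GraphSystem V) (N : ℕ)
variable {E : Type*} [NormedAddCommGroup E] [NormedSpace ℝ E] [FiniteDimensional ℝ E]
variable (G : Type*) [TopologicalSpace G] [ChartedSpace E G] [Group G] [LieGroup 𝓘(ℝ, E) ∞ G]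
  [RiemannianBundle (fun x : G => TangentSpace 𝓘(ℝ, E) x)]

/-- The Lie algebra of `G` with the inner product given by the metric of `G` at the identity. -/
noncomputable instance : NormedAddCommGroup (GroupLieAlgebra 𝓘(ℝ, E) G) :=
  instNormedAddCommGroupOfRiemannianBundleOfIsTopologicalAddGroupOfContinuousConstSMulReal
    (E := fun x : G => TangentSpace 𝓘(ℝ, E) x) 1
noncomputable instance : InnerProductSpace ℝ (GroupLieAlgebra 𝓘(ℝ, E) G) :=
  instInnerProductSpaceReal (E := fun x : G => TangentSpace 𝓘(ℝ, E) x) 1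

instance : FiniteDimensional ℝ (GroupLieAlgebra 𝓘(ℝ, E) G) :=
  inferInstanceAs (FiniteDimensional ℝ E)

/-- The metric of `G` is invariant under left and right translations. -/
def IsBiInvariantMetric : Prop :=
  (∀ (g x : G) (v w : TangentSpace 𝓘(ℝ, E) x),
    inner ℝ (mfderiv 𝓘(ℝ, E) 𝓘(ℝ, E) (fun y : G => g * y) x v)
      (mfderiv 𝓘(ℝ, E) 𝓘(ℝ, E) (fun y : G => g * y) x w) = inner ℝ v w) ∧
  (∀ (g x : G) (v w : TangentSpace 𝓘(ℝ, E) x),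
    inner ℝ (mfderiv 𝓘(ℝ, E) 𝓘(ℝ, E) (fun y : G => y * g) x v)
      (mfderiv 𝓘(ℝ, E) 𝓘(ℝ, E) (fun y : G => y * g) x w) = inner ℝ v w)

variable (E) in
/-- The (co)tangent space at the identity of `𝒜 n = G ^ Edge n`, with the product metric; the metric
identifies tangent and cotangent vectors. -/
abbrev TanA (n : ℕ) : Type _ := PiLp 2 fun _ : S.Edge n => GroupLieAlgebra 𝓘(ℝ, E) G

variable (E) in
/-- The fibre `M_N ⊗ Cl(T* 𝒜 n)`; left translations trivialize the Clifford bundle of `𝒜 n`, so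
that the sections of `M_N ⊗ Cl(T* 𝒜 n)` are the functions with values in this space. -/
abbrev FibA (n : ℕ) : Type _ := Fib N (TanA S E G n)

/-- The pull-back of (co)vectors under the structure map `𝒜 (n + 1) → 𝒜 n`, which deletes the
coordinates that are not of the form `fst e`: extension by zero. -/
noncomputable def tanPull (n : ℕ) : TanA S E G n →ₗᵢ[ℝ] TanA S E G (n + 1) where
  toFun v := WithLp.toLp 2 (Function.extend S.fst v.ofLp 0)
  map_add' v w := by
    ext c
    by_cases h : ∃ e, S.fst e = c
    · obtain ⟨e, rfl⟩ := h; simp [S.fst_inj.extend_apply]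
    · simp [Function.extend_apply' _ _ _ h]
  map_smul' r v := by
    ext c
    by_cases h : ∃ e, S.fst e = c
    · obtain ⟨e, rfl⟩ := h; simp [S.fst_inj.extend_apply]
    · simp [Function.extend_apply' _ _ _ h]
  norm_map' v := by
    classical
    rw [← sq_eq_sq₀ (norm_nonneg _) (norm_nonneg _), PiLp.norm_sq_eq_of_L2, PiLp.norm_sq_eq_of_L2]
    simp only [LinearMap.coe_mk, AddHom.coe_mk]
    rw [← Finset.sum_subset (Finset.subset_univ (Finset.univ.image S.fst)),
      Finset.sum_image (fun a _ b _ h => S.fst_inj h)]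
    · simp [S.fst_inj.extend_apply]
    · intro c _ hc
      rw [Function.extend_apply' _ _ _ (by simpa using hc)]
      simp

variable [IsTopologicalGroup G] [CompactSpace G] [SecondCountableTopology G]
  [MeasurableSpace G] [BorelSpace G]

/-- The normalized Haar measure of `𝒜 n = G ^ Edge n`. -/
noncomputable def haarA (n : ℕ) : Measure (S.Edge n → G) :=
  Measure.pi fun _ => Measure.haarMeasure (⊤ : TopologicalSpace.PositiveCompacts G)

instance : IsProbabilityMeasure (Measure.haarMeasure (⊤ : TopologicalSpace.PositiveCompacts G)) :=
  ⟨by simpa using Measure.haarMeasure_self (K₀ := (⊤ : TopologicalSpace.PositiveCompacts G))⟩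

instance (n : ℕ) : IsProbabilityMeasure (haarA S G n) := by unfold haarA; infer_instance

theorem measurePreserving_fst (n : ℕ) :
    MeasurePreserving (fun (g : S.Edge (n + 1) → G) e => g (S.fst e))
      (haarA S G (n + 1)) (haarA S G n) := by
  classical
  have hm : Measurable (fun (g : S.Edge (n + 1) → G) e => g (S.fst e)) :=
    measurable_pi_lambda _ fun e => measurable_pi_apply _
  refine ⟨hm, ?_⟩
  symm
  refine Measure.pi_eq fun s hs => ?_
  rw [Measure.map_apply hm (MeasurableSet.univ_pi hs)]
  have h : (fun (g : S.Edge (n + 1) → G) e => g (S.fst e)) ⁻¹' Set.univ.pi s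
      = Set.univ.pi (Function.extend S.fst s fun _ => Set.univ) := by
    ext g
    simp only [Set.mem_preimage, Set.mem_pi, Set.mem_univ, true_implies]
    constructor
    · intro hg c
      by_cases h : ∃ e, S.fst e = c
      · obtain ⟨e, rfl⟩ := h; rw [S.fst_inj.extend_apply]; exact hg e
      · rw [Function.extend_apply' _ _ _ h]; trivial
    · intro hg e
      have := hg (S.fst e)
      rwa [S.fst_inj.extend_apply] at this
  rw [h, haarA, Measure.pi_pi, ← Finset.prod_subset (Finset.subset_univ (Finset.univ.image S.fst)),
      Finset.prod_image (fun a _ b _ h => S.fst_inj h)]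
  · simp [S.fst_inj.extend_apply]
  · intro c _ hc
    rw [Function.extend_apply' _ _ _ (by simpa using hc)]
    simp

variable (E) in
/-- The Hilbert space `L²(𝒜 n, M_N ⊗ Cl(T* 𝒜 n))`. -/
abbrev L2A (n : ℕ) : Type _ := Lp (FibA S N E G n) 2 (haarA S G n)

variable (E) in
/-- The isometric embedding `L²(𝒜 n, M_N ⊗ Cl(T* 𝒜 n)) → L²(𝒜 (n + 1), M_N ⊗ Cl(T* 𝒜 (n + 1)))`
given by the pull-back of sections under the structure map. -/
noncomputable def pull (n : ℕ) : L2A S N E G n →ₗᵢ[ℂ] L2A S N E G (n + 1) :=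
  (compLp (haarA S G (n + 1)) (Fib.map (tanPull S G n))).comp
    (Lp.compMeasurePreservingₗᵢ ℂ _ (measurePreserving_fst S G n))

theorem pull_coe (n : ℕ) (f : L2A S N E G n) :
    pull S N E G n f =ᵐ[haarA S G (n + 1)]
      fun g => Fib.map (tanPull S G n) (f fun e => g (S.fst e)) := by
  refine (compLp_coe _ _ _).trans ?_
  filter_upwards [Lp.coeFn_compMeasurePreserving f (measurePreserving_fst S G n)] with g hg
  exact congrArg _ hg

variable (E) in
/-- The Hilbert space `L²(𝒜, M_N ⊗ Cl(T* 𝒜))` over the completed space of connections: the direct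
limit of the spaces `L²(𝒜 n, M_N ⊗ Cl(T* 𝒜 n))`. -/
abbrev HilbertA : Type _ := HilbertLim (pull S N E G)

/-! ### Holonomy operators -/

variable (E) in
/-- A unitary matrix representation of the Lie group `G`. -/
structure UnitaryRep where
  toHom : G →* Matrix.unitaryGroup (Fin N) ℂ
  smooth : ∀ i j, ContMDiff 𝓘(ℝ, E) 𝓘(ℝ, ℂ) ∞
    fun g => (toHom g : Matrix (Fin N) (Fin N) ℂ) i j

variable {S N G}

/-- Multiplication by a continuous function with values in the unitary matrices, as an isometry of
`L²(𝒜 n, M_N ⊗ Cl(T* 𝒜 n))`. -/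
noncomputable def mulL2 (n : ℕ) (u : (S.Edge n → G) → Matrix (Fin N) (Fin N) ℂ)
    (hu : Continuous u) (hU : ∀ g, u g ∈ Matrix.unitaryGroup (Fin N) ℂ) :
    L2A S N E G n →ₗᵢ[ℂ] L2A S N E G n :=
  have := secondCountableTopologyEither_of_left (S.Edge n → G) (FibA S N E G n →L[ℂ] FibA S N E G n)
  mulLp (haarA S G n) (fun g => Fib.matActL (u g))
    (Fib.continuous_matActL.comp hu).aestronglyMeasurable
    (fun g x => Fib.matAct_norm (hU g) x)

theorem mulL2_coe (n : ℕ) (u : (S.Edge n → G) → Matrix (Fin N) (Fin N) ℂ)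
    (hu : Continuous u) (hU : ∀ g, u g ∈ Matrix.unitaryGroup (Fin N) ℂ) (f : L2A S N E G n) :
    mulL2 n u hu hU f =ᵐ[haarA S G n] fun g => Fib.matAct (u g) (f g) :=
  have := secondCountableTopologyEither_of_left (S.Edge n → G) (FibA S N E G n →L[ℂ] FibA S N E G n)
  mulLp_coe (haarA S G n) (fun g => Fib.matActL (u g))
    (Fib.continuous_matActL.comp hu).aestronglyMeasurable
    (fun g x => Fib.matAct_norm (hU g) x) f

/-- The function `h_L` of a loop `L` in the coordinates of `𝒜 k`; it is meant for `k` at least the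
level of `L`, and is the constant function `1` otherwise. -/
noncomputable def loopFun (ρ : UnitaryRep N E G) {v : V} (L : S.Loop v) (k : ℕ) (g : S.Edge k → G) :
    Matrix (Fin N) (Fin N) ℂ :=
  if h : L.level ≤ k then ρ.toHom (L.holCoord h g) else 1

theorem loopFun_mem (ρ : UnitaryRep N E G) {v : V} (L : S.Loop v) (k : ℕ) (g : S.Edge k → G) :
    loopFun ρ L k g ∈ Matrix.unitaryGroup (Fin N) ℂ := by
  unfold loopFun
  split_ifs
  · exact SetLike.coe_mem _
  · exact one_mem _

theorem continuous_pathHol {n : ℕ} {X : Type*} [TopologicalSpace X] (g : X → S.Edge n → G)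
    (hg : ∀ e, Continuous fun x => g x e) (l : List (S.Edge n × Bool)) :
    Continuous fun x => GraphSystem.pathHol (g x) l := by
  induction l with
  | nil => exact continuous_const
  | cons s l ih =>
    simp only [GraphSystem.pathHol, List.map_cons, List.prod_cons] at ih ⊢
    refine Continuous.mul ?_ ih
    split_ifs
    · exact hg _
    · exact (hg _).inv

theorem continuous_loopFun (ρ : UnitaryRep N E G) {v : V} (L : S.Loop v) (k : ℕ) :
    Continuous (loopFun ρ L k) := by
  by_cases h : L.level ≤ k
  · have h1 : Continuous (L.holCoord h : (S.Edge k → G) → G) := by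
      refine continuous_pathHol _ (fun e => ?_) _
      unfold GraphSystem.thetaInv
      cases S.next L.level e with
      | none => exact continuous_apply _
      | some e' => exact (continuous_apply _).mul (continuous_apply _).inv
    have h2 : Continuous fun g : G => (ρ.toHom g : Matrix (Fin N) (Fin N) ℂ) :=
      continuous_matrix fun i j => (ρ.smooth i j).continuous
    have h3 : loopFun ρ L k = fun g => (ρ.toHom (L.holCoord h g) : Matrix (Fin N) (Fin N) ℂ) :=
      funext fun g => by rw [loopFun, dif_pos h]
    rw [h3]
    exact h2.comp h1
  · have h3 : loopFun ρ L k = fun _ => 1 := funext fun g => by rw [loopFun, dif_neg h]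
    rw [h3]; exact continuous_const

theorem loopFun_succ (ρ : UnitaryRep N E G) {v : V} (L : S.Loop v) {k : ℕ} (h : L.level ≤ k)
    (g : S.Edge (k + 1) → G) :
    loopFun ρ L (k + 1) g = loopFun ρ L k fun e => g (S.fst e) := by
  rw [loopFun, loopFun, dif_pos h, dif_pos (Nat.le_succ_of_le h)]
  simp only [GraphSystem.Loop.holCoord, S.incl_succ h]

/-- The function `h_L` on the completed space of connections. -/
noncomputable def holFun (ρ : UnitaryRep N E G) {v : V} (L : S.Loop v) (A : S.Connections G) :
    Matrix (Fin N) (Fin N) ℂ := ρ.toHom (L.hol A)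

theorem loopFun_theta (ρ : UnitaryRep N E G) {v : V} (L : S.Loop v) {k : ℕ} (h : L.level ≤ k)
    (A : S.Connections G) : loopFun ρ L k (S.theta k (A.1 k)) = holFun ρ L A := by
  rw [loopFun, dif_pos h, L.holCoord_theta, holFun]

/-- Multiplication by the function `h_L`, as an operator on `L²(𝒜, M_N ⊗ Cl(T* 𝒜))`. -/
noncomputable def holOp (ρ : UnitaryRep N E G) {v : V} (L : S.Loop v) :
    HilbertA S N E G →L[ℂ] HilbertA S N E G :=
  HilbertLim.lift (pull S N E G) L.level
    (fun k => mulL2 k (loopFun ρ L k) (continuous_loopFun ρ L k) (loopFun_mem ρ L k))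
    (fun k hk f => by
      ext1
      refine (mulL2_coe _ _ _ _ _).trans ?_
      refine Filter.EventuallyEq.trans ?_ (pull_coe S N G k _).symm
      filter_upwards [pull_coe S N G k f, (measurePreserving_fst S G k).quasiMeasurePreserving.ae
        (mulL2_coe k (loopFun ρ L k) (continuous_loopFun ρ L k) (loopFun_mem ρ L k) f)]
        with g h1 h2
      rw [h1, h2, loopFun_succ ρ L hk, Fib.map_matAct])

/-- The algebra `ℬ_v` of holonomy loops: the `*`-algebra generated by the `h_L`, for `L` a loop with
base point `v`, acting by multiplication. -/
noncomputable def loopAlgebra (ρ : UnitaryRep N E G) (S : GraphSystem V) (v : V) :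
    StarSubalgebra ℂ (HilbertA S N E G →L[ℂ] HilbertA S N E G) :=
  StarAlgebra.adjoin ℂ (Set.range fun L : S.Loop v => holOp ρ L)

/-! ### Dirac type operators -/

variable (E) in
/-- Smooth functions on the product manifold `𝒜 n = G ^ Edge n`. -/
def SmoothA {n : ℕ} {F : Type*} [NormedAddCommGroup F] [NormedSpace ℝ F]
    (f : (S.Edge n → G) → F) : Prop :=
  ContMDiff (ModelWithCorners.pi fun _ : S.Edge n => 𝓘(ℝ, E)) 𝓘(ℝ, F) ∞ f

open scoped Classical in
/-- The derivative of a function on `𝒜 n = G ^ Edge n` in direction of the left translated vector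
field of `X`, on the copy of `G` with label `c`. -/
noncomputable def leftDeriv {n : ℕ} {F : Type*} [NormedAddCommGroup F] [NormedSpace ℝ F]
    (c : S.Edge n) (X : GroupLieAlgebra 𝓘(ℝ, E) G) (f : (S.Edge n → G) → F) (g : S.Edge n → G) :
    F :=
  mfderiv 𝓘(ℝ, E) 𝓘(ℝ, F) (fun y : G => f (Function.update g c y)) (g c)
    (mulInvariantVectorField X (g c))

/-- The derivative `leftDeriv` of a matrix valued function, entry by entry. -/
noncomputable def leftDerivMat {n : ℕ} (c : S.Edge n) (X : GroupLieAlgebra 𝓘(ℝ, E) G)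
    (u : (S.Edge n → G) → Matrix (Fin N) (Fin N) ℂ) (g : S.Edge n → G) :
    Matrix (Fin N) (Fin N) ℂ :=
  Matrix.of fun i j => leftDeriv c X (fun g' => u g' i j) g

open scoped Classical in
/-- Clifford multiplication by the vector `X` on the copy of `G` with label `c`. -/
noncomputable def cliffA {n : ℕ} (c : S.Edge n) (X : GroupLieAlgebra 𝓘(ℝ, E) G) :
    FibA S N E G n →ₗ[ℂ] FibA S N E G n :=
  Fib.cliffAct (WithLp.toLp 2 (Pi.single c X))

variable {ι : Type*} [Fintype ι] (b : OrthonormalBasis ι ℝ (GroupLieAlgebra 𝓘(ℝ, E) G))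

/-- The bare Dirac type operator `∑ᵢ eᵢ · ∂_{eᵢ}` acting on the copy of `G` with label `c`. -/
noncomputable def diracOn {n : ℕ} (c : S.Edge n) (f : (S.Edge n → G) → FibA S N E G n)
    (g : S.Edge n → G) : FibA S N E G n :=
  ∑ i, cliffA c (b i) (leftDeriv c (b i) f g)

variable (a : ∀ n, S.Edge n → ℝ)

open scoped Classical in
/-- The coefficient of the copy of `G` with label `c` in `D n`. It is `a n c` if this copy occurs
for the first time at level `n`; otherwise it is the coefficient from the level before. -/
noncomputable def coeff (a : ∀ n, S.Edge n → ℝ) : ∀ n, S.Edge n → ℝ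
  | 0, c => a 0 c
  | n + 1, c => if h : ∃ e, S.fst e = c then coeff a n h.choose else a (n + 1) c

/-- The operator `D n`, acting on the sections of level `k ≥ n` through the coordinates of
level `n`. -/
noncomputable def diracAt {n k : ℕ} (h : n ≤ k) (f : (S.Edge k → G) → FibA S N E G k)
    (g : S.Edge k → G) : FibA S N E G k :=
  ∑ c : S.Edge n, coeff a n c • diracOn b (S.incl h c) f g

open scoped Classical in
/-- The recursion `D (n + 1) = E (D n) + ∑ a (n + 1) c • D_c`, the sum being over the coordinates
that are new at level `n + 1`. -/
theorem diracAt_succ {n k : ℕ} (h : n + 1 ≤ k) (f : (S.Edge k → G) → FibA S N E G k)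
    (g : S.Edge k → G) :
    diracAt b a h f g = diracAt b a (Nat.le_of_succ_le h) f g +
      ∑ c ∈ Finset.univ.filter (fun c : S.Edge (n + 1) => c ∉ Set.range S.fst),
        a (n + 1) c • diracOn b (S.incl h c) f g := by
  rw [diracAt, ← Finset.sum_filter_add_sum_filter_not Finset.univ
    (fun c : S.Edge (n + 1) => c ∈ Set.range S.fst)]
  congr 1
  · have h1 : Finset.univ.filter (fun c : S.Edge (n + 1) => c ∈ Set.range S.fst)
        = Finset.univ.image S.fst := by ext c; simp
    rw [h1, Finset.sum_image (fun a _ b _ h => S.fst_inj h), diracAt]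
    refine Finset.sum_congr rfl fun e _ => ?_
    have h2 : ∃ d, S.fst d = S.fst e := ⟨e, rfl⟩
    have h3 : coeff a (n + 1) (S.fst e) = coeff a n e := by
      rw [coeff, dif_pos h2, S.fst_inj h2.choose_spec]
    rw [h3, S.incl_fst h]
  · refine Finset.sum_congr rfl fun c hc => ?_
    have h2 : ¬ ∃ d, S.fst d = c := by simpa using hc
    rw [coeff, dif_neg h2]

/-- The `n`-th Dirac type operator `D n` on smooth sections over `𝒜 n`. -/
noncomputable def diracLevel (n : ℕ) (f : (S.Edge n → G) → FibA S N E G n) :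
    (S.Edge n → G) → FibA S N E G n :=
  diracAt b a (le_refl n) f

/-- `x` is the element of `L²(𝒜, M_N ⊗ Cl(T* 𝒜))` given by the function `f` on `𝒜 n`. -/
def Represents {n : ℕ} (f : (S.Edge n → G) → FibA S N E G n) (x : HilbertA S N E G) : Prop :=
  ∃ ξ : L2A S N E G n, ξ =ᵐ[haarA S G n] f ∧ x = HilbertLim.of (pull S N E G) n ξ

/-- The Dirac type operator `D` on `L²(𝒜, M_N ⊗ Cl(T* 𝒜))`, with domain the smooth sections over the
spaces `𝒜 n`, to which the operators `D n` descend. -/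
noncomputable def dirac : HilbertA S N E G →ₗ.[ℂ] HilbertA S N E G :=
  (Submodule.span ℂ {p : HilbertA S N E G × HilbertA S N E G |
    ∃ (n : ℕ) (f : (S.Edge n → G) → FibA S N E G n), SmoothA E f ∧
      Represents f p.1 ∧ Represents (diracLevel b a n f) p.2}).toLinearPMap

/-- `T` is a bounded operator that extends the commutator `[B, D] = B D - D B`, the operator `B`
preserving the domain of `D`. -/
def IsBoundedCommutator {H : Type*} [NormedAddCommGroup H] [InnerProductSpace ℂ H]
    (B : H →L[ℂ] H) (D : H →ₗ.[ℂ] H) (T : H →L[ℂ] H) : Prop :=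
  ∀ x : D.domain, ∃ h : B x ∈ D.domain, T x = B (D x) - D ⟨B x, h⟩

end Geometry

end LoopDirac

open LoopDirac MeasureTheory Manifold Bundle
open scoped ContDiff

/-! In the coordinates `theta` the structure maps only delete copies of `G`, and everything rests on
this. A section pulled back from level `n` is constant along the new copies, so the new summands of
the next operator annihilate it, while the old summands commute with pull-back
(`diracLevel_pullFun`). Any two smooth sections can therefore be compared at a common level. There
an element of the Hilbert space has at most one continuous representative, because Haar measure
charges every nonempty open set. Hence the graphs of the `D n` increase to the graph of a single
operator (`mem_graph_dirac`), whatever the coefficients are.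

For a loop, the Leibniz rule splits `D (h_L f)` into terms that differentiate `h_L` and terms that
differentiate `f`. Left matrix multiplication and Clifford multiplication act on different tensor
factors and commute, so the terms with derivatives of `f` cancel in the commutator
(`commutator_diracAt`). The function `h_L` depends only on the copies of `G` present at the level of
`L`, so later summands contribute nothing (`commutator_diracLevel`).

What remains is multiplication by derivatives of `h_L`. These are continuous on a compact space,
Clifford multiplication by a unit vector is isometric, and a matrix acts on `M_N(ℂ) ⊗ Cl(W)` with a
bound independent of `W` (`Fib.exists_norm_matAct_le_mul`). The resulting constant is the same at
all levels, so the commutator is bounded on the whole domain and extends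
(`exists_isBoundedCommutator`).

The passage to the algebra uses the product rule for commutators, together with the fact that the
adjoint of `h_L` is the holonomy operator of the reversed loop (`holOp_reverse`). -/

namespace LoopDirac

/-! ### Finite powers of a manifold and their smooth maps. -/

section PiManifold

variable {E : Type*} [NormedAddCommGroup E] [NormedSpace ℝ E]
  {G : Type*} [TopologicalSpace G] [ChartedSpace E G] {κ : Type*} [Fintype κ]

/-- The coordinates of a finite power of a manifold are smooth. -/
theorem contMDiff_pi_apply (i : κ) :
    ContMDiff (ModelWithCorners.pi fun _ : κ => 𝓘(ℝ, E)) 𝓘(ℝ, E) ∞ (fun g : κ → G => g i) := by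
  intro g
  rw [contMDiffAt_iff]
  refine ⟨(continuous_apply i).continuousAt, ?_⟩
  -- The chart of the power is the product of the charts, so in charts the coordinate map is a chart
  -- of `G` after its inverse, applied to `z i`. It is the linear projection as long as `z i` stays
  -- in the chart target.
  have h : ContDiffWithinAt ℝ ∞ (fun z : κ → E => z i)
      (Set.range (ModelWithCorners.pi fun _ : κ => 𝓘(ℝ, E)))
      (extChartAt (ModelWithCorners.pi fun _ : κ => 𝓘(ℝ, E)) g g) :=
    (contDiff_apply ℝ E i).contDiffWithinAt
  refine h.congr_of_eventuallyEq ?_ ?_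
  · have h2 : ∀ᶠ z : κ → E in nhds
        (extChartAt (ModelWithCorners.pi fun _ : κ => 𝓘(ℝ, E)) g g),
        z i ∈ (extChartAt 𝓘(ℝ, E) (g i)).target :=
      (continuous_apply i).continuousAt.preimage_mem_nhds
        (extChartAt_target_mem_nhds (I := 𝓘(ℝ, E)) (g i))
    filter_upwards [mem_nhdsWithin_of_mem_nhds h2] with z hz
    exact (extChartAt 𝓘(ℝ, E) (g i)).right_inv hz
  · exact (extChartAt 𝓘(ℝ, E) (g i)).right_inv (mem_extChartAt_target _)

/-- A map into a finite power of a manifold is smooth if its components are. -/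
theorem contMDiff_pi_of {E' : Type*} [NormedAddCommGroup E'] [NormedSpace ℝ E'] {H : Type*}
    [TopologicalSpace H] {I : ModelWithCorners ℝ E' H} {M : Type*} [TopologicalSpace M]
    [ChartedSpace H M] {φ : M → κ → G}
    (h : ∀ i, ContMDiff I 𝓘(ℝ, E) ∞ fun x => φ x i) :
    ContMDiff I (ModelWithCorners.pi fun _ : κ => 𝓘(ℝ, E)) ∞ φ := by
  intro x
  rw [contMDiffAt_iff]
  refine ⟨continuousAt_pi.2 fun i => (h i x).continuousAt, ?_⟩
  rw [contDiffWithinAt_pi]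
  intro i
  exact (contMDiffAt_iff.1 (h i x)).2

/-- A transition map between product charts is, in each component, a transition map of `G` after a
coordinate projection. Class `C¹` is all that the tangent coordinates of the next section require.
-/
theorem isManifold_pi [IsManifold 𝓘(ℝ, E) 1 G] :
    IsManifold (ModelWithCorners.pi fun _ : κ => 𝓘(ℝ, E)) 1 (κ → G) := by
  refine isManifold_of_contDiffOn _ _ _ ?_
  rintro _ _ ⟨e, he, rfl⟩ ⟨e', he', rfl⟩
  rw [contDiffOn_pi]
  intro i
  have h : ContDiffOn ℝ 1 (e' i ∘ (e i).symm) ((e i).symm.trans (e' i)).source := by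
    have h1 := HasGroupoid.compatible (G := contDiffGroupoid 1 𝓘(ℝ, E)) (he i trivial)
      (he' i trivial)
    rw [contDiffGroupoid, mem_groupoid_of_pregroupoid] at h1
    exact h1.1.mono fun z hz => ⟨hz, z, rfl⟩
  refine h.comp (contDiff_apply ℝ E i).contDiffOn ?_
  intro z hz
  have h1 : z ∈ (OpenPartialHomeomorph.pi e).symm.source := hz.1.1
  have h2 : (OpenPartialHomeomorph.pi e).symm z ∈ (OpenPartialHomeomorph.pi e').source := hz.1.2
  exact ⟨h1 i trivial, h2 i trivial⟩

variable {F : Type*} [NormedAddCommGroup F] [NormedSpace ℝ F]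

/-- The model has no boundary, so the derivative within its range is an ordinary one. This makes the
calculus rules of normed spaces available for functions on `G`. -/
theorem hasMFDerivAt_iff_hasFDerivAt {f : G → F} {x : G} {f' : E →L[ℝ] F} :
    HasMFDerivAt 𝓘(ℝ, E) 𝓘(ℝ, F) f x f' ↔ ContinuousAt f x ∧
      HasFDerivAt (f ∘ (extChartAt 𝓘(ℝ, E) x).symm) f' (extChartAt 𝓘(ℝ, E) x x) := by
  change ContinuousAt f x ∧ HasFDerivWithinAt (f ∘ (extChartAt 𝓘(ℝ, E) x).symm) f' (Set.range id)
    (extChartAt 𝓘(ℝ, E) x x) ↔ _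
  rw [Set.range_id, hasFDerivWithinAt_univ]

end PiManifold

/-! ### Continuous dependence of derivatives on parameters. -/

section ParametricDerivative

variable {E : Type*} [NormedAddCommGroup E] [NormedSpace ℝ E]
  {G : Type*} [TopologicalSpace G] [ChartedSpace E G] [IsManifold 𝓘(ℝ, E) 1 G]
  {E' : Type*} [NormedAddCommGroup E'] [NormedSpace ℝ E'] {H : Type*} [TopologicalSpace H]
  {I : ModelWithCorners ℝ E' H} {M : Type*} [TopologicalSpace M] [ChartedSpace H M] [IsManifold I 1 M]
  {F : Type*} [NormedAddCommGroup F] [NormedSpace ℝ F]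

/-- The derivative in the second variable, at a fixed point, of a smooth function of two variables
depends continuously on the first variable. -/
theorem continuous_mfderiv_right {φ : M → G → F} (o : G)
    (hφ : ContMDiff (I.prod 𝓘(ℝ, E)) 𝓘(ℝ, F) ∞ (Function.uncurry φ)) (X : TangentSpace 𝓘(ℝ, E) o) :
    Continuous (Y := F) fun x => mfderiv 𝓘(ℝ, E) 𝓘(ℝ, F) (φ x) o X := by
  refine continuous_iff_continuousAt.2 fun x₀ => ?_
  -- This gives continuity of the derivative only when it is read in tangent coordinates around
  -- `x₀`.
  have h := (ContMDiffAt.mfderiv (m := 0) (n := ∞) (J := I) (x₀ := x₀) φ (fun _ => o) (hφ _)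
    contMDiffAt_const (by norm_num)).continuousAt
  -- Both coordinate changes are trivial: the base point in `G` stays at `o`, and the target is a
  -- vector space.
  have h2 : (inTangentCoordinates 𝓘(ℝ, E) 𝓘(ℝ, F) (fun _ => o) (fun x => φ x o)
      (fun x => mfderiv 𝓘(ℝ, E) 𝓘(ℝ, F) (φ x) o) x₀ : M → E →L[ℝ] F) =
      fun x => (mfderiv 𝓘(ℝ, E) 𝓘(ℝ, F) (φ x) o : E →L[ℝ] F) := by
    funext x
    refine (inTangentCoordinates_eq (fun _ => o) (fun x => φ x o) _ (x₀ := x₀) (x := x)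
      (mem_chart_source E o) (Set.mem_univ _)).trans ?_
    refine ContinuousLinearMap.ext fun w => ?_
    change (tangentBundleCore 𝓘(ℝ, F) F).coordChange _ _ _
      ((mfderiv 𝓘(ℝ, E) 𝓘(ℝ, F) (φ x) o : E →L[ℝ] F) ((tangentBundleCore 𝓘(ℝ, E) G).coordChange _ _ _ w)) = _
    rw [(tangentBundleCore 𝓘(ℝ, E) G).coordChange_self _ _ (mem_chart_source E o),
      tangentBundleCore_coordChange_model_space]
    rfl
  rw [h2] at h
  exact ContinuousAt.clm_apply (E := E) (F := F) h continuousAt_const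

end ParametricDerivative

end LoopDirac

namespace LoopDirac

/-! ### Calculus of left invariant derivatives on powers of `G`. -/

section LeftDeriv

variable {V : Type*} {S : GraphSystem V}
variable {E : Type*} [NormedAddCommGroup E] [NormedSpace ℝ E]
variable {G : Type*} [TopologicalSpace G] [ChartedSpace E G]
variable {F : Type*} [NormedAddCommGroup F] [NormedSpace ℝ F]
  {F' : Type*} [NormedAddCommGroup F'] [NormedSpace ℝ F']
variable {n : ℕ}

theorem SmoothA.clm_comp {f : (S.Edge n → G) → F} (hf : SmoothA E f) (A : F →L[ℝ] F') :
    SmoothA E fun g => A (f g) :=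
  A.contMDiff.comp hf

theorem SmoothA.add {f f' : (S.Edge n → G) → F} (hf : SmoothA E f) (hf' : SmoothA E f') :
    SmoothA E fun g => f g + f' g :=
  ContMDiff.add hf hf'

theorem SmoothA.clm_apply {Φ : (S.Edge n → G) → F →L[ℝ] F'} {f : (S.Edge n → G) → F}
    (hΦ : SmoothA E Φ) (hf : SmoothA E f) : SmoothA E fun g => Φ g (f g) :=
  ContMDiff.clm_apply hΦ hf

theorem SmoothA.comp_index {m : ℕ} {f : (S.Edge m → G) → F} (hf : SmoothA E f)
    (j : S.Edge m → S.Edge n) : SmoothA E fun g : S.Edge n → G => f fun e => g (j e) :=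
  ContMDiff.comp (g := f) hf (contMDiff_pi_of fun e => contMDiff_pi_apply (j e))

open scoped Classical in
theorem SmoothA.update {f : (S.Edge n → G) → F} (hf : SmoothA E f) (c : S.Edge n)
    (g : S.Edge n → G) : ContMDiff 𝓘(ℝ, E) 𝓘(ℝ, F) ∞ fun y : G => f (Function.update g c y) := by
  refine ContMDiff.comp (g := f) hf (contMDiff_pi_of fun e => ?_)
  by_cases h : e = c
  · subst h
    refine contMDiff_id.congr fun y => ?_
    simp
  · refine (contMDiff_const (c := g e)).congr fun y => ?_
    simp [h]

variable [Group G]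

theorem leftDeriv_eq_of_hasMFDerivAt {f : (S.Edge n → G) → F} {c : S.Edge n} {g : S.Edge n → G}
    {D : E →L[ℝ] F} (X : GroupLieAlgebra 𝓘(ℝ, E) G)
    (h : open scoped Classical in
      HasMFDerivAt 𝓘(ℝ, E) 𝓘(ℝ, F) (fun y : G => f (Function.update g c y)) (g c) D) :
    leftDeriv c X f g = D (mulInvariantVectorField X (g c)) := by
  exact congrArg (fun D : E →L[ℝ] F => D (mulInvariantVectorField X (g c))) h.mfderiv

-- A single continuous linear map computes the derivatives in all directions `X`; the calculus rules
-- below are verified on this map.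
open scoped Classical in
theorem SmoothA.hasMFDerivAt {f : (S.Edge n → G) → F} (hf : SmoothA E f) (c : S.Edge n)
    (g : S.Edge n → G) : ∃ D : E →L[ℝ] F,
      HasMFDerivAt 𝓘(ℝ, E) 𝓘(ℝ, F) (fun y : G => f (Function.update g c y)) (g c) D ∧
      ∀ X : GroupLieAlgebra 𝓘(ℝ, E) G,
        leftDeriv c X f g = D (mulInvariantVectorField X (g c)) :=
  ⟨_, ((hf.update c g).mdifferentiableAt (by simp)).hasMFDerivAt, fun _ => rfl⟩

theorem leftDeriv_clm_comp {f : (S.Edge n → G) → F} (hf : SmoothA E f) (A : F →L[ℝ] F')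
    (c : S.Edge n) (X : GroupLieAlgebra 𝓘(ℝ, E) G) (g : S.Edge n → G) :
    leftDeriv c X (fun g => A (f g)) g = A (leftDeriv c X f g) := by
  classical
  obtain ⟨D, hD, h⟩ := hf.hasMFDerivAt c g
  rw [h, leftDeriv_eq_of_hasMFDerivAt (D := A.comp D)]
  · rfl
  · rw [hasMFDerivAt_iff_hasFDerivAt] at hD ⊢
    exact ⟨A.continuous.continuousAt.comp hD.1, A.hasFDerivAt.comp _ hD.2⟩

theorem leftDeriv_add {f f' : (S.Edge n → G) → F} (hf : SmoothA E f) (hf' : SmoothA E f')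
    (c : S.Edge n) (X : GroupLieAlgebra 𝓘(ℝ, E) G) (g : S.Edge n → G) :
    leftDeriv c X (fun g => f g + f' g) g = leftDeriv c X f g + leftDeriv c X f' g := by
  classical
  obtain ⟨D, hD, h⟩ := hf.hasMFDerivAt c g
  obtain ⟨D', hD', h'⟩ := hf'.hasMFDerivAt c g
  rw [h, h', leftDeriv_eq_of_hasMFDerivAt (D := D + D')]
  · rfl
  · rw [hasMFDerivAt_iff_hasFDerivAt] at hD hD' ⊢
    exact ⟨hD.1.add hD'.1, hD.2.add hD'.2⟩

/-- The Leibniz rule. -/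
theorem leftDeriv_clm_apply {Φ : (S.Edge n → G) → F →L[ℝ] F'} {f : (S.Edge n → G) → F}
    (hΦ : SmoothA E Φ) (hf : SmoothA E f)
    (c : S.Edge n) (X : GroupLieAlgebra 𝓘(ℝ, E) G) (g : S.Edge n → G) :
    leftDeriv c X (fun g => Φ g (f g)) g =
      leftDeriv c X Φ g (f g) + Φ g (leftDeriv c X f g) := by
  classical
  obtain ⟨D, hD, h⟩ := hf.hasMFDerivAt c g
  obtain ⟨D', hD', h'⟩ := hΦ.hasMFDerivAt c g
  rw [h, h', leftDeriv_eq_of_hasMFDerivAt (D := (Φ g).comp D + D'.flip (f g))]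
  · change Φ g _ + D' _ (f g) = _
    rw [add_comm]
    rfl
  · rw [hasMFDerivAt_iff_hasFDerivAt] at hD hD' ⊢
    refine ⟨hD'.1.clm_apply hD.1, ?_⟩
    -- The product rule evaluates `Φ` and `f` at `Function.update g c (g c)`, seen through the chart
    -- and its inverse; this point is `g`.
    convert! hD'.2.clm_apply hD.2 using 2 <;> simp

theorem leftDeriv_of_update_eq {f : (S.Edge n → G) → F} {c : S.Edge n} {g : S.Edge n → G}
    (X : GroupLieAlgebra 𝓘(ℝ, E) G)
    (h : open scoped Classical in ∀ y, f (Function.update g c y) = f g) :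
    leftDeriv c X f g = 0 := by
  classical
  rw [leftDeriv_eq_of_hasMFDerivAt (D := 0)]
  · rfl
  · have h1 : (fun y => f (Function.update g c y)) = fun _ : G => f g := funext h
    exact h1 ▸ hasMFDerivAt_const (f g) (g c)

/-- Because `j` is injective, varying the coordinate `j c` of `g` varies only the coordinate `c` of
the relabelled point. Together with the vanishing along copies outside the range of `j`, this yields
both the compatibility of the operators `D n` and the independence of the commutators from the
level. -/
theorem leftDeriv_comp_index {m : ℕ} (f : (S.Edge m → G) → F) {j : S.Edge m → S.Edge n}
    (hj : Function.Injective j) (c : S.Edge m) (X : GroupLieAlgebra 𝓘(ℝ, E) G)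
    (g : S.Edge n → G) :
    leftDeriv (j c) X (fun g => f fun e => g (j e)) g = leftDeriv c X f fun e => g (j e) := by
  classical
  have h : (fun y : G => f fun e => Function.update g (j c) y (j e)) =
      fun y => f (Function.update (fun e => g (j e)) c y) :=
    funext fun y => congrArg f (Function.update_comp_eq_of_injective g hj c y)
  exact congrArg (fun φ : G → F => (mfderiv 𝓘(ℝ, E) 𝓘(ℝ, F) φ (g (j c)) : E →L[ℝ] F)
    (mulInvariantVectorField X (g (j c)))) h

theorem leftDeriv_comp_index_of_notMem {m : ℕ} (f : (S.Edge m → G) → F)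
    {j : S.Edge m → S.Edge n} {c : S.Edge n} (hc : c ∉ Set.range j)
    (X : GroupLieAlgebra 𝓘(ℝ, E) G) (g : S.Edge n → G) :
    leftDeriv c X (fun g => f fun e => g (j e)) g = 0 := by
  classical
  refine leftDeriv_of_update_eq X fun y => ?_
  congr 1
  funext e
  rw [Function.update_of_ne fun h => hc ⟨e, h⟩]

variable [LieGroup 𝓘(ℝ, E) ∞ G]

/-- The invariant field at `g c` is the image of `X` under the derivative of left translation, so
the chain rule moves the differentiation to the identity. There neither the base point nor the
vector depends on `g`, which is the situation of `continuous_mfderiv_right`. -/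
theorem SmoothA.leftDeriv_eq_mfderiv_one {f : (S.Edge n → G) → F} (hf : SmoothA E f)
    (c : S.Edge n) (X : GroupLieAlgebra 𝓘(ℝ, E) G) (g : S.Edge n → G) :
    leftDeriv c X f g = open scoped Classical in mfderiv 𝓘(ℝ, E) 𝓘(ℝ, F)
      (fun y : G => f (Function.update g c (g c * y))) 1 X := by
  classical
  have h1 : MDifferentiableAt 𝓘(ℝ, E) 𝓘(ℝ, E) (fun y : G => g c * y) 1 :=
    (contMDiff_mul_left (I := 𝓘(ℝ, E)) (n := ∞)).mdifferentiableAt (by simp)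
  have h2 : MDifferentiableAt 𝓘(ℝ, E) 𝓘(ℝ, F) (fun y : G => f (Function.update g c y))
      (g c * 1) := (hf.update c g).mdifferentiableAt (by simp)
  have h3 := mfderiv_comp (1 : G) h2 h1
  have h4 := congrArg (fun D : E →L[ℝ] F => D X) h3
  refine Eq.trans ?_ h4.symm
  change _ = mfderiv 𝓘(ℝ, E) 𝓘(ℝ, F) (fun y : G => f (Function.update g c y)) (g c * 1)
    (mulInvariantVectorField X (g c))
  rw [mul_one]
  rfl

theorem SmoothA.continuous_leftDeriv {f : (S.Edge n → G) → F} (hf : SmoothA E f)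
    (c : S.Edge n) (X : GroupLieAlgebra 𝓘(ℝ, E) G) : Continuous (leftDeriv c X f) := by
  classical
  have : IsManifold 𝓘(ℝ, E) ∞ G := inferInstance
  have : IsManifold 𝓘(ℝ, E) 1 G := IsManifold.of_le (n := ∞) (by norm_num)
  have := isManifold_pi (E := E) (G := G) (κ := S.Edge n)
  have h := continuous_mfderiv_right (I := ModelWithCorners.pi fun _ : S.Edge n => 𝓘(ℝ, E))
    (φ := fun (g : S.Edge n → G) (y : G) => f (Function.update g c (g c * y))) 1 ?_ X
  · exact h.congr fun g => (hf.leftDeriv_eq_mfderiv_one c X g).symm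
  · refine ContMDiff.comp (g := f) hf (contMDiff_pi_of fun e => ?_)
    by_cases h : e = c
    · subst h
      refine (ContMDiff.mul (I := 𝓘(ℝ, E)) ((contMDiff_pi_apply e).comp contMDiff_fst)
        contMDiff_snd).congr fun p => ?_
      simp
    · refine ((contMDiff_pi_apply e).comp contMDiff_fst).congr fun p => ?_
      simp [h]

end LeftDeriv

end LoopDirac

namespace LoopDirac

/-! ### Matrix and Clifford actions on the fibre, with bounds uniform in `W`. -/

section FibreLemmas

open scoped TensorProduct

universe w

variable {N : ℕ} {W : Type*} [NormedAddCommGroup W] [InnerProductSpace ℝ W]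

/-- Clifford multiplication by a unit vector is an isometry of the Clifford algebra. -/
noncomputable def Cl.mulLeftₗᵢ [FiniteDimensional ℝ W] {v : W} (hv : ‖v‖ = 1) :
    Cl W →ₗᵢ[ℝ] Cl W :=
  (LinearMap.mulLeft ℝ (Cl.vec v)).isometryOfInner fun x y => by
    have h : star (Cl.vec v) * Cl.vec v = 1 := by
      rw [Cl.star_vec, neg_mul, Cl.vec_mul_self, real_inner_self_eq_norm_sq, hv]; simp
    change Cl.tr (star (Cl.vec v * x) * (Cl.vec v * y)) = Cl.tr (star x * y)
    rw [star_mul, mul_assoc, ← mul_assoc (star (Cl.vec v)), h, one_mul]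

namespace Fib

variable [FiniteDimensional ℝ W] {W' : Type*} [NormedAddCommGroup W'] [InnerProductSpace ℝ W']
  [FiniteDimensional ℝ W']

theorem norm_cliffAct {v : W} (hv : ‖v‖ = 1) (x : Fib N W) : ‖cliffAct v x‖ = ‖x‖ :=
  TensorProduct.norm_map (LinearIsometry.id (R := ℝ) (E := MatSpace N)) (Cl.mulLeftₗᵢ hv) x

theorem lin_ext {M : Type*} [AddCommMonoid M] [Module ℂ M] [Module ℝ M] [IsScalarTower ℝ ℂ M]
    {f g : Fib N W →ₗ[ℂ] M}
    (h : ∀ (A : MatSpace N) (y : Cl W), f (show Fib N W from A ⊗ₜ[ℝ] y) =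
      g (show Fib N W from A ⊗ₜ[ℝ] y)) : f = g :=
  TensorProduct.AlgebraTensorModule.ext (R := ℝ) (A := ℂ) (M := MatSpace N) (N := Cl W) h

/-- The two actions live on different tensor factors. This commutation is what cancels the terms
with derivatives of the section in the commutator. -/
theorem cliffAct_matAct (v : W) (A : Matrix (Fin N) (Fin N) ℂ) (x : Fib N W) :
    cliffAct v (matAct A x) = matAct A (cliffAct v x) := by
  have h : (cliffAct v ∘ₗ matAct A : Fib N W →ₗ[ℂ] Fib N W) = matAct A ∘ₗ cliffAct v :=
    lin_ext fun _ _ => rfl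
  exact LinearMap.congr_fun h x

/-- `Cl.map f` is multiplicative and extends `f` on vectors, which settles the matter on pure
tensors. -/
theorem map_cliffAct (f : W →ₗᵢ[ℝ] W') (v : W) (x : Fib N W) :
    map f (cliffAct v x) = cliffAct (f v) (map f x) := by
  have h : (map f : Fib N W →ₗᵢ[ℂ] Fib N W').toLinearMap ∘ₗ cliffAct v =
      cliffAct (f v) ∘ₗ (map f : Fib N W →ₗᵢ[ℂ] Fib N W').toLinearMap := by
    refine lin_ext fun A y => ?_
    change A ⊗ₜ[ℝ] Cl.map f (Cl.vec v * y) = A ⊗ₜ[ℝ] (Cl.vec (f v) * Cl.map f y)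
    rw [map_mul, Cl.map_vec]
  exact LinearMap.congr_fun h x

theorem matAct_one (x : Fib N W) : matAct 1 x = x := by
  have h : (matAct 1 : Fib N W →ₗ[ℂ] Fib N W) = LinearMap.id := by
    refine lin_ext fun A y => ?_
    change matMul 1 A ⊗ₜ[ℝ] y = A ⊗ₜ[ℝ] y
    congr 1
    ext p
    simp [matMul, Matrix.one_apply]
  rw [h, LinearMap.id_apply]

theorem matAct_mul (A B : Matrix (Fin N) (Fin N) ℂ) (x : Fib N W) :
    matAct (A * B) x = matAct A (matAct B x) := by
  have h : (matAct (A * B) : Fib N W →ₗ[ℂ] Fib N W) = matAct A ∘ₗ matAct B := by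
    refine lin_ext fun X y => ?_
    change matMul (A * B) X ⊗ₜ[ℝ] y = matMul A (matMul B X) ⊗ₜ[ℝ] y
    congr 1
    ext p
    simp only [matMul, LinearMap.coe_mk, AddHom.coe_mk, Matrix.mul_apply, Finset.sum_mul,
      Finset.mul_sum, mul_assoc]
    exact Finset.sum_comm
  rw [h, LinearMap.comp_apply]

open scoped Matrix.Norms.L2Operator in
/-- The norm of the action of a matrix on `M_N(ℂ) ⊗ Cl(W)` is bounded independently of `W`. -/
theorem exists_norm_matAct_le (A : Matrix (Fin N) (Fin N) ℂ) :
    ∃ C : ℝ, 0 ≤ C ∧ ∀ (W : Type w) [NormedAddCommGroup W] [InnerProductSpace ℝ W]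
      [FiniteDimensional ℝ W] (x : Fib N W), ‖matAct A x‖ ≤ C * ‖x‖ := by
  -- Every matrix is a linear combination of unitaries, and a unitary acts isometrically for every
  -- `W`. A bound is thus obtained from the coefficients alone, without reference to the dimension
  -- of `Cl W`.
  have hA : A ∈ Submodule.span ℂ (unitary (Matrix (Fin N) (Fin N) ℂ) : Set _) := by
    rw [CStarAlgebra.span_unitary]; trivial
  induction hA using Submodule.span_induction with
  | mem U hU => exact ⟨1, zero_le_one, fun W _ _ _ x => by rw [matAct_norm hU, one_mul]⟩
  | zero =>
    refine ⟨0, le_rfl, fun W _ _ _ x => ?_⟩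
    have h := matAct_smul 0 (0 : Matrix (Fin N) (Fin N) ℂ) x
    rw [zero_smul, zero_smul] at h
    rw [h, norm_zero, zero_mul]
  | add A B _ _ hA hB =>
    obtain ⟨C, hC, h⟩ := hA
    obtain ⟨C', hC', h'⟩ := hB
    refine ⟨C + C', add_nonneg hC hC', fun W _ _ _ x => ?_⟩
    rw [matAct_add, add_mul]
    exact (norm_add_le _ _).trans (add_le_add (h W x) (h' W x))
  | smul c A _ hA =>
    obtain ⟨C, hC, h⟩ := hA
    refine ⟨‖c‖ * C, by positivity, fun W _ _ _ x => ?_⟩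
    rw [matAct_smul, norm_smul, mul_assoc]
    exact mul_le_mul_of_nonneg_left (h W x) (norm_nonneg c)

theorem matAct_eq_sum (A : Matrix (Fin N) (Fin N) ℂ) (x : Fib N W) :
    matAct A x = ∑ i, ∑ j, A i j • matAct (Matrix.single i j 1) x := by
  change matActL A x = ∑ i, ∑ j, A i j • matActL (Matrix.single i j 1) x
  conv_lhs => rw [Matrix.matrix_eq_sum_single A]
  simp only [map_sum, sum_apply]
  refine Finset.sum_congr rfl fun i _ => Finset.sum_congr rfl fun j _ => ?_
  have h : Matrix.single i j (A i j) = A i j • Matrix.single i j (1 : ℂ) := by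
    rw [Matrix.smul_single, smul_eq_mul, mul_one]
  rw [h, map_smul, smul_apply]

-- Expansion in matrix units reduces the bound to finitely many fixed matrices, whose constants are
-- added up. The constant precedes `W` and `A` in the quantifiers: it has to serve all points of all
-- levels, while the Clifford algebras grow with the level.
variable (N) in
theorem exists_norm_matAct_le_mul :
    ∃ C : ℝ, 0 ≤ C ∧ ∀ (W : Type w) [NormedAddCommGroup W] [InnerProductSpace ℝ W]
      [FiniteDimensional ℝ W] (A : Matrix (Fin N) (Fin N) ℂ) (M : ℝ) (_ : ∀ i j, ‖A i j‖ ≤ M)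
      (x : Fib N W), ‖matAct A x‖ ≤ C * M * ‖x‖ := by
  choose C hC h using fun p : Fin N × Fin N =>
    exists_norm_matAct_le.{w} (Matrix.single p.1 p.2 (1 : ℂ))
  refine ⟨∑ i, ∑ j, C (i, j), Finset.sum_nonneg fun i _ => Finset.sum_nonneg fun j _ => hC _,
    fun W _ _ _ A M hA x => ?_⟩
  rw [matAct_eq_sum]
  simp only [Finset.sum_mul]
  refine (norm_sum_le _ _).trans (Finset.sum_le_sum fun i _ =>
    (norm_sum_le _ _).trans (Finset.sum_le_sum fun j _ => ?_))
  rw [norm_smul, mul_comm (C (i, j)), mul_assoc]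
  exact mul_le_mul (hA i j) (h (i, j) W x) (norm_nonneg _) ((norm_nonneg _).trans (hA i j))

/-- The action of matrices on the fibre, as a real linear map on families of entries. -/
noncomputable def entriesAct : (Fin N → Fin N → ℂ) →L[ℝ] (Fib N W →L[ℝ] Fib N W) :=
  LinearMap.toContinuousLinearMap
    { toFun := fun A => (matActL (Matrix.of A)).restrictScalars ℝ
      map_add' := fun A B => by ext x; exact matAct_add (Matrix.of A) (Matrix.of B) x
      map_smul' := fun r A => by
        ext x
        refine (matAct_smul (r : ℂ) (Matrix.of A) x).trans ?_
        exact algebraMap_smul ℂ r (matAct (Matrix.of A) x) }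

/-- Multiplication by a complex number, as a real linear map. -/
noncomputable def smulL (c : ℂ) : Fib N W →L[ℝ] Fib N W :=
  ContinuousLinearMap.restrictScalars ℝ (c • ContinuousLinearMap.id ℂ (Fib N W))

/-- The embedding `Fib.map`, as a real linear map. -/
noncomputable def mapL (f : W →ₗᵢ[ℝ] W') : Fib N W →L[ℝ] Fib N W' :=
  ContinuousLinearMap.restrictScalars ℝ (map f).toContinuousLinearMap

theorem map_real_smul (f : W →ₗᵢ[ℝ] W') (r : ℝ) (x : Fib N W) : map f (r • x) = r • map f x :=
  (mapL f).map_smul r x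

theorem matAct_real_smul (A : Matrix (Fin N) (Fin N) ℂ) (r : ℝ) (x : Fib N W) :
    matAct A (r • x) = r • matAct A x :=
  map_smul ((matAct A).restrictScalars ℝ) r x

theorem entriesAct_apply (A : Fin N → Fin N → ℂ) (x : Fib N W) :
    entriesAct A x = matAct (Matrix.of A) x := rfl

end Fib

end FibreLemmas

/-! ### Matrix functions and Clifford vectors acting on sections. -/

section Sections

variable {V : Type*} {S : GraphSystem V} {N : ℕ}
variable {E : Type*} [NormedAddCommGroup E] [NormedSpace ℝ E] [FiniteDimensional ℝ E]
variable {G : Type*} [TopologicalSpace G] [ChartedSpace E G] [Group G] [LieGroup 𝓘(ℝ, E) ∞ G]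
  [RiemannianBundle (fun x : G => TangentSpace 𝓘(ℝ, E) x)]
variable {n : ℕ}

theorem smoothA_entries {u : (S.Edge n → G) → Matrix (Fin N) (Fin N) ℂ}
    (hu : ∀ i j, SmoothA E fun g => u g i j) :
    SmoothA (F := Fin N → Fin N → ℂ) E fun g i j => u g i j :=
  contMDiff_pi_space.2 fun i => contMDiff_pi_space.2 fun j => hu i j

theorem SmoothA.matAct {u : (S.Edge n → G) → Matrix (Fin N) (Fin N) ℂ}
    (hu : ∀ i j, SmoothA E fun g => u g i j) {f : (S.Edge n → G) → FibA S N E G n}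
    (hf : SmoothA E f) : SmoothA E fun g => Fib.matAct (u g) (f g) :=
  ((smoothA_entries hu).clm_comp Fib.entriesAct).clm_apply hf

theorem leftDeriv_matAct {u : (S.Edge n → G) → Matrix (Fin N) (Fin N) ℂ}
    (hu : ∀ i j, SmoothA E fun g => u g i j) {f : (S.Edge n → G) → FibA S N E G n}
    (hf : SmoothA E f) (c : S.Edge n) (X : GroupLieAlgebra 𝓘(ℝ, E) G) (g : S.Edge n → G) :
    leftDeriv c X (fun g => Fib.matAct (u g) (f g)) g =
      Fib.matAct (leftDerivMat c X u g) (f g) + Fib.matAct (u g) (leftDeriv c X f g) := by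
  have h := leftDeriv_clm_apply ((smoothA_entries hu).clm_comp Fib.entriesAct) hf c X g
  refine h.trans (congrArg (· + _) ?_)
  rw [leftDeriv_clm_comp (smoothA_entries hu)]
  refine (Fib.entriesAct_apply _ _).trans (congrArg (fun A => Fib.matAct A (f g)) ?_)
  ext i j
  -- Reading off one entry is continuous and linear, so it commutes with the derivative; this
  -- identifies the derivative of the family of entries with `leftDerivMat`.
  let pr : (Fin N → Fin N → ℂ) →L[ℝ] ℂ :=
    (ContinuousLinearMap.proj (R := ℝ) (φ := fun _ : Fin N => ℂ) j).comp
      (ContinuousLinearMap.proj (R := ℝ) (φ := fun _ : Fin N => Fin N → ℂ) i)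
  exact (leftDeriv_clm_comp (smoothA_entries hu) pr c X g).symm

theorem cliffA_matAct (c : S.Edge n) (X : GroupLieAlgebra 𝓘(ℝ, E) G)
    (A : Matrix (Fin N) (Fin N) ℂ) (x : FibA S N E G n) :
    cliffA c X (Fib.matAct A x) = Fib.matAct A (cliffA c X x) :=
  Fib.cliffAct_matAct _ _ _

theorem norm_cliffA (c : S.Edge n) {X : GroupLieAlgebra 𝓘(ℝ, E) G} (hX : ‖X‖ = 1)
    (x : FibA S N E G n) : ‖cliffA c X x‖ = ‖x‖ := by
  classical
  refine Fib.norm_cliffAct ?_ x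
  exact (PiLp.norm_single 2 (fun _ : S.Edge n => GroupLieAlgebra 𝓘(ℝ, E) G) c X).trans hX

theorem tanPull_single [DecidableEq (S.Edge n)] [DecidableEq (S.Edge (n + 1))] (c : S.Edge n)
    (X : GroupLieAlgebra 𝓘(ℝ, E) G) :
    tanPull S G n (WithLp.toLp 2 (Pi.single c X)) = WithLp.toLp 2 (Pi.single (S.fst c) X) := by
  ext d
  change Function.extend S.fst (Pi.single c X) 0 d =
    (Pi.single (S.fst c) X : S.Edge (n + 1) → GroupLieAlgebra 𝓘(ℝ, E) G) d
  by_cases h : ∃ e, S.fst e = d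
  · obtain ⟨e, rfl⟩ := h
    rw [S.fst_inj.extend_apply]
    by_cases he : e = c
    · subst he; simp
    · rw [Pi.single_eq_of_ne he, Pi.single_eq_of_ne fun h => he (S.fst_inj h)]
  · rw [Function.extend_apply' _ _ _ h, Pi.single_eq_of_ne fun h' => h ⟨c, h'.symm⟩]
    rfl

theorem map_cliffA (c : S.Edge n) (X : GroupLieAlgebra 𝓘(ℝ, E) G) (x : FibA S N E G n) :
    Fib.map (tanPull S G n) (cliffA c X x) = cliffA (S.fst c) X (Fib.map (tanPull S G n) x) := by
  classical
  refine (Fib.map_cliffAct _ _ _).trans ?_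
  unfold cliffA
  congr 2
  convert tanPull_single c X

end Sections

end LoopDirac

namespace LoopDirac

/-! ### Elements of a Hilbert space direct limit. -/

namespace HilbertLim

variable {H : ℕ → Type*} [∀ n, NormedAddCommGroup (H n)] [∀ n, InnerProductSpace ℂ (H n)]
  (J : ∀ n, H n →ₗᵢ[ℂ] H (n + 1))

/-- The embeddings into the direct limit are compatible with the structure maps. -/
theorem of_succ (n : ℕ) (x : H n) : of J (n + 1) (J n x) = of J n x := by
  have hp : ∀ k, n + 1 ≤ k → push J (n + 1) (J n x) k = push J n x k := by
    intro k hk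
    induction k, hk using Nat.le_induction with
    | base => rw [push_self, push_succ J x le_rfl, push_self]
    | succ k hk ih => rw [push_succ J _ hk, push_succ J _ (Nat.le_of_succ_le hk), ih]
  -- The two sequences can differ at index `n`, where the one starting later is `0` by default.
  -- Their difference has seminorm zero, and only the separated completion identifies them.
  obtain ⟨m, hm⟩ := EvCoherent.norm_spec (ofAux J (n + 1) (J n x) - ofAux J n x)
  have h0 : ‖ofAux J (n + 1) (J n x) - ofAux J n x‖ = 0 := by
    rw [hm _ (le_max_left m (n + 1))]
    change ‖push J (n + 1) (J n x) _ - push J n x _‖ = 0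
    rw [hp _ (le_max_right m (n + 1)), sub_self, norm_zero]
  rw [← sub_eq_zero, ← norm_eq_zero]
  change ‖UniformSpace.Completion.toComplₗᵢ (𝕜 := ℂ) (ofAux J (n + 1) (J n x)) -
    UniformSpace.Completion.toComplₗᵢ (𝕜 := ℂ) (ofAux J n x)‖ = 0
  rw [← map_sub, LinearIsometry.norm_map, h0]

/-- From the index where a sequence becomes coherent, it is the push-forward of its entry there; the
earlier entries do not affect the seminorm. -/
theorem exists_of_eq_of (x : EvCoherent J) : ∃ (n : ℕ) (y : H n), (x : HilbertLim J) = of J n y := by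
  obtain ⟨m, hm⟩ := x.2
  have hp : ∀ k, m ≤ k → push J m (x.1 m) k = x.1 k := by
    intro k hk
    induction k, hk using Nat.le_induction with
    | base => rw [push_self]
    | succ k hk ih => rw [push_succ J _ hk, ih, hm k hk]
  refine ⟨m, x.1 m, ?_⟩
  obtain ⟨m', hm'⟩ := EvCoherent.norm_spec (x - ofAux J m (x.1 m))
  have h0 : ‖x - ofAux J m (x.1 m)‖ = 0 := by
    rw [hm' _ (le_max_left m' m)]
    change ‖x.1 _ - push J m (x.1 m) _‖ = 0
    rw [hp _ (le_max_right m' m), sub_self, norm_zero]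
  rw [← sub_eq_zero, ← norm_eq_zero]
  change ‖UniformSpace.Completion.toComplₗᵢ (𝕜 := ℂ) x -
    UniformSpace.Completion.toComplₗᵢ (𝕜 := ℂ) (ofAux J m (x.1 m))‖ = 0
  rw [← map_sub, LinearIsometry.norm_map, h0]

/-- A closed condition that holds on the images of all `H n` with `n ≥ m` holds everywhere. -/
theorem induction_of {P : HilbertLim J → Prop} (m : ℕ) (hP : IsClosed {x | P x})
    (h : ∀ n, m ≤ n → ∀ y : H n, P (of J n y)) (x : HilbertLim J) : P x := by
  refine UniformSpace.Completion.induction_on x hP fun x => ?_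
  obtain ⟨n, y, hy⟩ := exists_of_eq_of J x
  -- Raising the representative by `m` levels brings it to a level that is at least `m`, whatever
  -- `n` was.
  have hk : ∀ k, ∃ y : H (n + k), (x : HilbertLim J) = of J (n + k) y := by
    intro k
    induction k with
    | zero => exact ⟨y, hy⟩
    | succ k ih =>
      obtain ⟨y, hy⟩ := ih
      exact ⟨J _ y, hy.trans (of_succ J _ y).symm⟩
  obtain ⟨y, hy⟩ := hk m
  rw [hy]
  exact h _ (Nat.le_add_left m n) y

end HilbertLim

section Geometry

variable {V : Type*} {S : GraphSystem V} {N : ℕ}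
variable {E : Type*} [NormedAddCommGroup E] [NormedSpace ℝ E] [FiniteDimensional ℝ E]
variable {G : Type*} [TopologicalSpace G] [ChartedSpace E G] [Group G] [LieGroup 𝓘(ℝ, E) ∞ G]
  [RiemannianBundle (fun x : G => TangentSpace 𝓘(ℝ, E) x)]

/-- The pull-back of sections under the structure map. -/
noncomputable def pullFun {n : ℕ} (f : (S.Edge n → G) → FibA S N E G n) (g : S.Edge (n + 1) → G) :
    FibA S N E G (n + 1) :=
  Fib.map (tanPull S G n) (f fun e => g (S.fst e))

/-! ### Functions at a finite level and the elements they represent. -/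

section Represents

variable [IsTopologicalGroup G] [CompactSpace G] [SecondCountableTopology G]
  [MeasurableSpace G] [BorelSpace G]

/-- Compactness makes the section bounded, and the measure is finite. -/
theorem memLp_of_continuous {n : ℕ} {f : (S.Edge n → G) → FibA S N E G n} (hf : Continuous f) :
    MemLp f 2 (haarA S G n) := by
  obtain ⟨C, hC⟩ := isCompact_univ.exists_bound_of_continuousOn hf.continuousOn
  exact MemLp.of_bound hf.aestronglyMeasurable C (Filter.Eventually.of_forall fun g => hC g trivial)

theorem exists_represents {n : ℕ} {f : (S.Edge n → G) → FibA S N E G n} (hf : Continuous f) :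
    ∃ x, Represents f x :=
  ⟨_, (memLp_of_continuous hf).toLp, (memLp_of_continuous hf).coeFn_toLp, rfl⟩

theorem Represents.unique {n : ℕ} {f : (S.Edge n → G) → FibA S N E G n} {x y : HilbertA S N E G}
    (hx : Represents f x) (hy : Represents f y) : x = y := by
  obtain ⟨ξ, hξ, rfl⟩ := hx
  obtain ⟨η, hη, rfl⟩ := hy
  rw [Lp.ext (hξ.trans hη.symm)]

theorem Represents.add {n : ℕ} {f f' : (S.Edge n → G) → FibA S N E G n} {x x' : HilbertA S N E G}
    (hx : Represents f x) (hx' : Represents f' x') :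
    Represents (fun g => f g + f' g) (x + x') := by
  obtain ⟨ξ, hξ, rfl⟩ := hx
  obtain ⟨η, hη, rfl⟩ := hx'
  exact ⟨ξ + η, (Lp.coeFn_add ξ η).trans (hξ.add hη), (map_add _ _ _).symm⟩

theorem Represents.smul {n : ℕ} {f : (S.Edge n → G) → FibA S N E G n} {x : HilbertA S N E G}
    (hx : Represents f x) (c : ℂ) : Represents (fun g => c • f g) (c • x) := by
  obtain ⟨ξ, hξ, rfl⟩ := hx
  exact ⟨c • ξ, (Lp.coeFn_smul c ξ).trans (hξ.const_smul c), (map_smul _ _ _).symm⟩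

theorem Represents.sub {n : ℕ} {f f' : (S.Edge n → G) → FibA S N E G n} {x x' : HilbertA S N E G}
    (hx : Represents f x) (hx' : Represents f' x') :
    Represents (fun g => f g - f' g) (x - x') := by
  obtain ⟨ξ, hξ, rfl⟩ := hx
  obtain ⟨η, hη, rfl⟩ := hx'
  exact ⟨ξ - η, (Lp.coeFn_sub ξ η).trans (hξ.sub hη), (map_sub _ _ _).symm⟩

/-- This is what permits raising the level of a section without changing the element it represents.
Null sets pull back to null sets because deleting coordinates preserves Haar measure. -/
theorem Represents.pullFun {n : ℕ} {f : (S.Edge n → G) → FibA S N E G n} {x : HilbertA S N E G}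
    (hx : Represents f x) : Represents (pullFun f) x := by
  obtain ⟨ξ, hξ, rfl⟩ := hx
  refine ⟨pull S N E G n ξ, (pull_coe S N G n ξ).trans ?_, (HilbertLim.of_succ _ n ξ).symm⟩
  filter_upwards [(measurePreserving_fst S G n).quasiMeasurePreserving.ae hξ] with g hg
  rw [hg, LoopDirac.pullFun]

theorem Represents.ae_eq {n : ℕ} {f f' : (S.Edge n → G) → FibA S N E G n} {x : HilbertA S N E G}
    (hx : Represents f x) (hx' : Represents f' x) : f =ᵐ[haarA S G n] f' := by
  obtain ⟨ξ, hξ, rfl⟩ := hx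
  obtain ⟨η, hη, h⟩ := hx'
  rw [(HilbertLim.of (pull S N E G) n).injective h] at hξ
  exact hξ.symm.trans hη

instance (n : ℕ) : (haarA S G n).IsOpenPosMeasure := by
  unfold haarA; infer_instance

/-- The embedding of a level is injective, so the two functions agree almost everywhere, and
continuous functions that agree almost everywhere are equal when nonempty open sets have positive
measure. Differentiating a representative is thereby unambiguous. -/
theorem Represents.eq_of_continuous {n : ℕ} {f f' : (S.Edge n → G) → FibA S N E G n}
    {x : HilbertA S N E G} (hx : Represents f x) (hx' : Represents f' x) (hf : Continuous f)
    (hf' : Continuous f') : f = f' :=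
  (Continuous.ae_eq_iff_eq (haarA S G n) hf hf').1 (hx.ae_eq hx')

set_option synthInstance.maxHeartbeats 200000 in
theorem Represents.norm_le {n : ℕ} {f f' : (S.Edge n → G) → FibA S N E G n}
    {x x' : HilbertA S N E G} (hx : Represents f x) (hx' : Represents f' x') {C : ℝ}
    (h : ∀ g, ‖f g‖ ≤ C * ‖f' g‖) : ‖x‖ ≤ C * ‖x'‖ := by
  obtain ⟨ξ, hξ, rfl⟩ := hx
  obtain ⟨η, hη, rfl⟩ := hx'
  rw [LinearIsometry.norm_map, LinearIsometry.norm_map]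
  refine Lp.norm_le_mul_norm_of_ae_le_mul ?_
  filter_upwards [hξ, hη] with g h1 h2
  rw [h1, h2]
  exact h g

end Represents

/-! ### Pull-back and commutators of the operators `D n`. -/

section Dirac

variable [IsTopologicalGroup G] [CompactSpace G] [SecondCountableTopology G]
  [MeasurableSpace G] [BorelSpace G]

variable {ι : Type*} [Fintype ι] (b : OrthonormalBasis ι ℝ (GroupLieAlgebra 𝓘(ℝ, E) G))
  (a : ∀ n, S.Edge n → ℝ)

theorem SmoothA.smul {n : ℕ} {f : (S.Edge n → G) → FibA S N E G n} (hf : SmoothA E f) (c : ℂ) :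
    SmoothA E fun g => c • f g :=
  hf.clm_comp (Fib.smulL c)

theorem SmoothA.pullFun {n : ℕ} {f : (S.Edge n → G) → FibA S N E G n} (hf : SmoothA E f) :
    SmoothA E (pullFun f) :=
  (hf.comp_index S.fst).clm_comp (Fib.mapL (tanPull S G n))

theorem diracOn_add {n : ℕ} (c : S.Edge n) {f f' : (S.Edge n → G) → FibA S N E G n}
    (hf : SmoothA E f) (hf' : SmoothA E f') (g : S.Edge n → G) :
    diracOn b c (fun g => f g + f' g) g = diracOn b c f g + diracOn b c f' g := by
  simp only [diracOn, leftDeriv_add hf hf', map_add, Finset.sum_add_distrib]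

theorem diracOn_smul {n : ℕ} (c : S.Edge n) {f : (S.Edge n → G) → FibA S N E G n}
    (hf : SmoothA E f) (z : ℂ) (g : S.Edge n → G) :
    diracOn b c (fun g => z • f g) g = z • diracOn b c f g := by
  have h := fun i => leftDeriv_clm_comp hf (Fib.smulL z) c (b i) g
  have h' : ∀ i, leftDeriv c (b i) (fun g => z • f g) g = z • leftDeriv c (b i) f g := h
  simp only [diracOn, h', map_smul, Finset.smul_sum]

theorem diracLevel_add {n : ℕ} {f f' : (S.Edge n → G) → FibA S N E G n}
    (hf : SmoothA E f) (hf' : SmoothA E f') :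
    diracLevel b a n (fun g => f g + f' g) =
      fun g => diracLevel b a n f g + diracLevel b a n f' g := by
  funext g
  simp only [diracLevel, diracAt, diracOn_add b _ hf hf', smul_add, Finset.sum_add_distrib]

theorem diracLevel_smul {n : ℕ} {f : (S.Edge n → G) → FibA S N E G n}
    (hf : SmoothA E f) (z : ℂ) :
    diracLevel b a n (fun g => z • f g) = fun g => z • diracLevel b a n f g := by
  funext g
  simp only [diracLevel, diracAt, diracOn_smul b _ hf, Finset.smul_sum]
  exact Finset.sum_congr rfl fun c _ => smul_comm _ _ _

theorem continuous_diracOn {n : ℕ} (c : S.Edge n) {f : (S.Edge n → G) → FibA S N E G n}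
    (hf : SmoothA E f) : Continuous (diracOn b c f) :=
  continuous_finsetSum _ fun i _ =>
    (LinearMap.continuous_of_finiteDimensional (cliffA c (b i))).comp
      (hf.continuous_leftDeriv c (b i))

theorem continuous_diracLevel {n : ℕ} {f : (S.Edge n → G) → FibA S N E G n}
    (hf : SmoothA E f) : Continuous (diracLevel b a n f) :=
  continuous_finsetSum _ fun c _ =>
    (continuous_const_smul (coeff a n c)).comp (continuous_diracOn b (S.incl le_rfl c) hf)

/-- Pull-back carries the derivative along `c` to the one along `S.fst c`, and Clifford
multiplication on the copy `c` to that on the copy `S.fst c`. -/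
theorem diracOn_pullFun {n : ℕ} (c : S.Edge n) {f : (S.Edge n → G) → FibA S N E G n}
    (hf : SmoothA E f) (g : S.Edge (n + 1) → G) :
    diracOn b (S.fst c) (pullFun f) g = pullFun (diracOn b c f) g := by
  have h : ∀ i, leftDeriv (S.fst c) (b i) (pullFun f) g =
      Fib.map (tanPull S G n) (leftDeriv c (b i) f fun e => g (S.fst e)) := fun i => by
    rw [← leftDeriv_comp_index f S.fst_inj]
    exact leftDeriv_clm_comp (hf.comp_index S.fst)
      (Fib.mapL (tanPull S G n)) (S.fst c) (b i) g
  simp only [diracOn, pullFun, map_sum, h, map_cliffA]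

/-- A pulled back section is constant along a new copy of `G`. For this reason the coefficients
attached to new copies play no role in the compatibility of the operators. -/
theorem diracOn_pullFun_of_notMem {n : ℕ} {c : S.Edge (n + 1)} (hc : c ∉ Set.range S.fst)
    (f : (S.Edge n → G) → FibA S N E G n) (g : S.Edge (n + 1) → G) :
    diracOn b c (pullFun f) g = 0 := by
  refine Finset.sum_eq_zero fun i _ => ?_
  have h : leftDeriv c (b i) (pullFun f) g = 0 :=
    leftDeriv_comp_index_of_notMem (fun g => Fib.map (tanPull S G n) (f g)) hc (b i) g
  rw [h, map_zero]

set_option maxHeartbeats 1000000 in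
/-- The operators `D n` are compatible with the pull-back of sections. -/
theorem diracLevel_pullFun {n : ℕ} {f : (S.Edge n → G) → FibA S N E G n} (hf : SmoothA E f) :
    diracLevel b a (n + 1) (pullFun f) = pullFun (diracLevel b a n f) := by
  classical
  funext g
  rw [diracLevel, diracAt_succ, Finset.sum_eq_zero, add_zero]
  · simp only [diracLevel, diracAt, pullFun, map_sum]
    refine Finset.sum_congr rfl fun c _ => ?_
    rw [Fib.map_real_smul, S.incl_succ le_rfl, S.incl_self]
    exact congrArg _ (diracOn_pullFun b c hf g)
  · intro c hc
    rw [S.incl_self, diracOn_pullFun_of_notMem b (by simpa using hc), smul_zero]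

theorem coeff_fst {n : ℕ} (c : S.Edge n) : coeff a (n + 1) (S.fst c) = coeff a n c := by
  have h : ∃ d, S.fst d = S.fst c := ⟨c, rfl⟩
  rw [coeff, dif_pos h, S.fst_inj h.choose_spec]

theorem coeff_incl {n k : ℕ} (h : n ≤ k) (c : S.Edge n) : coeff a k (S.incl h c) = coeff a n c := by
  induction k, h using Nat.le_induction with
  | base => rw [S.incl_self]
  | succ k h ih => rw [S.incl_succ h, coeff_fst, ih]

theorem incl_injective {n k : ℕ} (h : n ≤ k) : Function.Injective (S.incl h) := by
  induction k, h using Nat.le_induction with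
  | base => intro c d hcd; rwa [S.incl_self, S.incl_self] at hcd
  | succ k h ih =>
    intro c d hcd
    rw [S.incl_succ h, S.incl_succ h] at hcd
    exact ih (S.fst_inj hcd)

/-- The commutator of a matrix valued function with a Dirac type operator. -/
theorem commutator_diracAt {m k : ℕ} (h : m ≤ k) {u : (S.Edge k → G) → Matrix (Fin N) (Fin N) ℂ}
    (hu : ∀ i j, SmoothA E fun g => u g i j) {f : (S.Edge k → G) → FibA S N E G k}
    (hf : SmoothA E f) (g : S.Edge k → G) :
    Fib.matAct (u g) (diracAt b a h f g) - diracAt b a h (fun g => Fib.matAct (u g) (f g)) g =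
      -∑ c : S.Edge m, coeff a m c • ∑ i, cliffA (S.incl h c) (b i)
        (Fib.matAct (leftDerivMat (S.incl h c) (b i) u g) (f g)) := by
  -- The Leibniz rule produces two families of terms. Once `u` is moved past the Clifford
  -- multiplications, those with the derivative of `f` occur with both signs and cancel.
  simp only [diracAt, diracOn, map_sum, Fib.matAct_real_smul, leftDeriv_matAct hu hf, map_add, cliffA_matAct,
    Finset.sum_add_distrib, smul_add]
  abel

theorem leftDerivMat_comp_incl_of_notMem {m k : ℕ} (h : m ≤ k)
    (u : (S.Edge m → G) → Matrix (Fin N) (Fin N) ℂ) {c : S.Edge k}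
    (hc : c ∉ Set.range (S.incl h)) (X : GroupLieAlgebra 𝓘(ℝ, E) G) (g : S.Edge k → G) :
    leftDerivMat c X (fun g => u fun e => g (S.incl h e)) g = 0 := by
  ext i j
  exact leftDeriv_comp_index_of_notMem (fun g => u g i j) hc X g

theorem leftDerivMat_comp_incl {m k : ℕ} (h : m ≤ k)
    (u : (S.Edge m → G) → Matrix (Fin N) (Fin N) ℂ) (c : S.Edge m)
    (X : GroupLieAlgebra 𝓘(ℝ, E) G) (g : S.Edge k → G) :
    leftDerivMat (S.incl h c) X (fun g => u fun e => g (S.incl h e)) g =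
      leftDerivMat c X u fun e => g (S.incl h e) := by
  ext i j
  exact leftDeriv_comp_index (fun g => u g i j) (incl_injective h) c X g

/-- If a matrix valued function depends on the coordinates of level `m` only, then all the later
Dirac type operators have the same commutator with it. -/
theorem commutator_diracLevel {m k : ℕ} (h : m ≤ k)
    {u : (S.Edge m → G) → Matrix (Fin N) (Fin N) ℂ} (hu : ∀ i j, SmoothA E fun g => u g i j)
    {f : (S.Edge k → G) → FibA S N E G k} (hf : SmoothA E f) (g : S.Edge k → G) :
    Fib.matAct (u fun e => g (S.incl h e)) (diracLevel b a k f g) -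
        diracLevel b a k (fun g => Fib.matAct (u fun e => g (S.incl h e)) (f g)) g =
      Fib.matAct (u fun e => g (S.incl h e)) (diracAt b a h f g) -
        diracAt b a h (fun g => Fib.matAct (u fun e => g (S.incl h e)) (f g)) g := by
  classical
  have hu' : ∀ i j, SmoothA E fun g : S.Edge k → G => u (fun e => g (S.incl h e)) i j :=
    fun i j => (hu i j).comp_index (S.incl h)
  rw [commutator_diracAt b a h hu' hf, diracLevel, diracLevel,
    commutator_diracAt b a le_rfl hu' hf]
  congr 1
  simp only [S.incl_self]
  -- The sum over all copies at level `k` reduces to the copies coming from level `m`, since `u` is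
  -- constant along the others; on the surviving copies the coefficients of the two levels agree.
  rw [← Finset.sum_subset (Finset.subset_univ (Finset.univ.image (S.incl h))),
    Finset.sum_image (fun c _ d _ hcd => incl_injective h hcd)]
  · simp only [coeff_incl]
  · intro c _ hc
    have hc' : c ∉ Set.range (S.incl h) := by simpa using hc
    have h0 : ∀ y : FibA S N E G k, Fib.matAct 0 y = 0 := fun y => by
      have := Fib.matAct_smul 0 0 y
      rwa [zero_smul, zero_smul] at this
    simp only [leftDerivMat_comp_incl_of_notMem h u hc', h0, map_zero, Finset.sum_const_zero,
      smul_zero]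

end Dirac

end Geometry

end LoopDirac

namespace LoopDirac

/-! ### Bounded commutators with an unbounded operator. -/

section BoundedCommutators

variable {H : Type*} [NormedAddCommGroup H] [InnerProductSpace ℂ H] {D : H →ₗ.[ℂ] H}

/-- In terms of the graph, preservation of the domain and the value of the commutator become one
existence statement, free of dependent membership proofs and easy to compose. -/
theorem isBoundedCommutator_iff {B T : H →L[ℂ] H} :
    IsBoundedCommutator B D T ↔
      ∀ x y, (x, y) ∈ D.graph → ∃ z, (B x, z) ∈ D.graph ∧ T x = B y - z := by
  constructor
  · intro h x y hxy
    obtain ⟨x', rfl, rfl⟩ := LinearPMap.mem_graph_iff _ |>.1 hxy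
    obtain ⟨h1, h2⟩ := h x'
    exact ⟨_, D.mem_graph ⟨_, h1⟩, h2⟩
  · intro h x
    obtain ⟨z, hz, hT⟩ := h _ _ (D.mem_graph x)
    obtain ⟨x', h1 : (x' : H) = B x, h2 : D x' = z⟩ := LinearPMap.mem_graph_iff _ |>.1 hz
    have h3 : B x ∈ D.domain := h1 ▸ x'.2
    refine ⟨h3, ?_⟩
    have h4 : x' = ⟨B x, h3⟩ := Subtype.ext h1
    rw [hT, ← h2, h4]

theorem IsBoundedCommutator.add {B B' T T' : H →L[ℂ] H} (h : IsBoundedCommutator B D T)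
    (h' : IsBoundedCommutator B' D T') : IsBoundedCommutator (B + B') D (T + T') := by
  rw [isBoundedCommutator_iff] at *
  intro x y hxy
  obtain ⟨z, hz, hT⟩ := h x y hxy
  obtain ⟨z', hz', hT'⟩ := h' x y hxy
  refine ⟨z + z', D.graph.add_mem hz hz', ?_⟩
  simp only [add_apply, hT, hT']
  abel

/-- This is the product rule `[B B', D] = B [B', D] + [B, D] B'`; its last term makes sense because
`B'` preserves the domain. -/
theorem IsBoundedCommutator.mul {B B' T T' : H →L[ℂ] H} (h : IsBoundedCommutator B D T)
    (h' : IsBoundedCommutator B' D T') :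
    IsBoundedCommutator (B * B') D (B * T' + T * B') := by
  rw [isBoundedCommutator_iff] at *
  intro x y hxy
  obtain ⟨z', hz', hT'⟩ := h' x y hxy
  obtain ⟨z, hz, hT⟩ := h _ _ hz'
  refine ⟨z, hz, ?_⟩
  change B (T' x) + T (B' x) = B (B' y) - z
  rw [hT, hT', map_sub]
  abel

theorem isBoundedCommutator_algebraMap (c : ℂ) :
    IsBoundedCommutator (algebraMap ℂ (H →L[ℂ] H) c) D 0 := by
  rw [isBoundedCommutator_iff]
  intro x y hxy
  refine ⟨c • y, D.graph.smul_mem c hxy, ?_⟩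
  exact (sub_self (c • y)).symm

/-- A commutator that is bounded on the domain extends to a bounded operator. -/
theorem exists_isBoundedCommutator [CompleteSpace H] {B : H →L[ℂ] H} {C : ℝ}
    (h : ∀ x y, (x, y) ∈ D.graph → ∃ z, (B x, z) ∈ D.graph ∧ ‖B y - z‖ ≤ C * ‖x‖) :
    ∃ T, IsBoundedCommutator B D T := by
  have hdom : ∀ x : D.domain, ∃ hx : B x ∈ D.domain, ‖B (D x) - D ⟨B x, hx⟩‖ ≤ C * ‖x‖ := by
    intro x
    obtain ⟨z, hz, hC⟩ := h _ _ (D.mem_graph x)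
    obtain ⟨x', h1 : (x' : H) = B x, h2 : D x' = z⟩ := LinearPMap.mem_graph_iff _ |>.1 hz
    have h3 : B x ∈ D.domain := h1 ▸ x'.2
    have h4 : x' = ⟨B x, h3⟩ := Subtype.ext h1
    exact ⟨h3, by rwa [← h4, h2]⟩
  choose hB hC using hdom
  let BD : D.domain →ₗ[ℂ] D.domain := B.toLinearMap.restrict fun x hx => hB ⟨x, hx⟩
  let T₀ : D.domain →ₗ[ℂ] H := B.toLinearMap ∘ₗ D.toFun - D.toFun ∘ₗ BD
  -- Density of the domain is not assumed: the commutator is extended by continuity to the closure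
  -- `K` and then composed with the orthogonal projection onto `K`.
  let K := D.domain.topologicalClosure
  let e : D.domain →ₗ[ℂ] K := Submodule.inclusion D.domain.le_topologicalClosure
  have : CompleteSpace K := D.domain.isClosed_topologicalClosure.completeSpace_coe
  have hd : DenseRange e := by
    intro x
    rw [closure_subtype]
    refine closure_mono ?_ x.2
    intro y hy
    exact ⟨e ⟨y, hy⟩, ⟨_, rfl⟩, rfl⟩
  refine ⟨(T₀.extendOfNorm e).comp K.orthogonalProjectionOnto, fun x => ⟨hB x, ?_⟩⟩
  have h1 : K.orthogonalProjectionOnto x = e x :=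
    Submodule.orthogonalProjectionOnto_mem_subspace_eq_self (e x)
  rw [ContinuousLinearMap.comp_apply, h1, LinearMap.extendOfNorm_eq hd ⟨C, hC⟩]
  rfl

/-- Since `U` preserves inner products and `U U' = 1`, one has `⟪U' x, y⟫ = ⟪U U' x, U y⟫ = ⟪x, U
y⟫`. -/
theorem eq_adjoint_of_isometry [CompleteSpace H] {U U' : H →L[ℂ] H} (hU : ∀ x, ‖U x‖ = ‖x‖)
    (h : ∀ x, U (U' x) = x) : U' = star U := by
  rw [ContinuousLinearMap.star_eq_adjoint, ContinuousLinearMap.eq_adjoint_iff]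
  intro x y
  have h1 := LinearIsometry.inner_map_map (⟨U.toLinearMap, hU⟩ : H →ₗᵢ[ℂ] H) (U' x) y
  exact h1.symm.trans (congrArg (fun z => inner ℂ z (U y)) (h x))

end BoundedCommutators

/-! ### Reversed paths and loops. -/

namespace GraphSystem

variable {V : Type*} {S : GraphSystem V}

theorem IsPath.append {n : ℕ} {u v w : V} {l l' : List (S.Edge n × Bool)} (h : S.IsPath u v l)
    (h' : S.IsPath v w l') : S.IsPath u w (l ++ l') := by
  induction l generalizing u with
  | nil => obtain rfl : u = v := h; exact h'
  | cons s l ih => exact ⟨h.1, ih h.2⟩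

/-- The reversed path. -/
def revPath {n : ℕ} (l : List (S.Edge n × Bool)) : List (S.Edge n × Bool) :=
  (l.map fun s => (s.1, !s.2)).reverse

theorem IsPath.revPath {n : ℕ} {v w : V} {l : List (S.Edge n × Bool)} (h : S.IsPath v w l) :
    S.IsPath w v (revPath l) := by
  induction l generalizing v with
  | nil => exact Eq.symm h
  | cons s l ih =>
    rw [GraphSystem.revPath, List.map_cons, List.reverse_cons]
    refine (ih h.2).append ⟨?_, ?_⟩
    · obtain ⟨e, d⟩ := s
      cases d <;> rfl
    · obtain ⟨e, d⟩ := s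
      refine Eq.trans ?_ h.1
      cases d <;> rfl

theorem pathHol_revPath {G : Type*} [Group G] {n : ℕ} (g : S.Edge n → G)
    (l : List (S.Edge n × Bool)) : pathHol g (revPath l) = (pathHol g l)⁻¹ := by
  rw [pathHol, pathHol, List.prod_inv_reverse, revPath, List.map_reverse, List.map_map,
    List.map_map]
  congr 3
  funext s
  obtain ⟨e, d⟩ := s
  cases d <;> simp

/-- The reversed loop. -/
def Loop.reverse {v : V} (L : S.Loop v) : S.Loop v := ⟨L.level, revPath L.path, L.isPath.revPath⟩

end GraphSystem

/-! ### Holonomy functions and holonomy operators. -/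

section Loops

variable {V : Type*} {S : GraphSystem V} {N : ℕ}
variable {E : Type*} [NormedAddCommGroup E] [NormedSpace ℝ E] [FiniteDimensional ℝ E]
variable {G : Type*} [TopologicalSpace G] [ChartedSpace E G] [Group G] [LieGroup 𝓘(ℝ, E) ∞ G]
  [RiemannianBundle (fun x : G => TangentSpace 𝓘(ℝ, E) x)]
  [IsTopologicalGroup G] [CompactSpace G] [SecondCountableTopology G]
  [MeasurableSpace G] [BorelSpace G]
variable (ρ : UnitaryRep N E G) {v : V} (L : S.Loop v)

/-- From its own level on, a loop function sees only the coordinates inherited from that level; this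
is the hypothesis of `commutator_diracLevel`. -/
theorem loopFun_eq_level {k : ℕ} (h : L.level ≤ k) :
    loopFun ρ L k = fun g : S.Edge k → G => loopFun ρ L L.level fun e => g (S.incl h e) := by
  funext g
  rw [loopFun, loopFun, dif_pos h, dif_pos le_rfl]
  simp only [GraphSystem.Loop.holCoord, S.incl_self]

theorem loopFun_reverse_mul (k : ℕ) (g : S.Edge k → G) :
    loopFun ρ L.reverse k g * loopFun ρ L k g = 1 ∧
      loopFun ρ L k g * loopFun ρ L.reverse k g = 1 := by
  by_cases h : L.level ≤ k
  · have h1 : L.reverse.holCoord h g = (L.holCoord h g)⁻¹ := GraphSystem.pathHol_revPath _ _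
    have h' : L.reverse.level ≤ k := h
    rw [loopFun, loopFun, dif_pos h', dif_pos h, h1]
    simp only [← Submonoid.coe_mul, ← map_mul]
    simp
  -- Below the level of the loop both functions take the default value `1`, so the identity still
  -- holds.
  · have h' : ¬ L.reverse.level ≤ k := h
    rw [loopFun, loopFun, dif_neg h', dif_neg h]
    simp

theorem contMDiff_pathHol {E' : Type*} [NormedAddCommGroup E'] [NormedSpace ℝ E'] {H : Type*}
    [TopologicalSpace H] {I : ModelWithCorners ℝ E' H} {X : Type*} [TopologicalSpace X]
    [ChartedSpace H X] {n : ℕ} (g : X → S.Edge n → G)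
    (hg : ∀ e, ContMDiff I 𝓘(ℝ, E) ∞ fun x => g x e) (l : List (S.Edge n × Bool)) :
    ContMDiff I 𝓘(ℝ, E) ∞ fun x => GraphSystem.pathHol (g x) l := by
  induction l with
  | nil => exact contMDiff_const
  | cons s l ih =>
    simp only [GraphSystem.pathHol, List.map_cons, List.prod_cons] at ih ⊢
    refine ContMDiff.mul ?_ ih
    split_ifs
    · exact hg _
    · exact (hg _).inv

/-- In the new coordinates the holonomy is a product of coordinates and their inverses, and the
entries of `ρ` are smooth. -/
theorem smoothA_loopFun (k : ℕ) (i j : Fin N) :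
    SmoothA E fun g : S.Edge k → G => loopFun ρ L k g i j := by
  by_cases h : L.level ≤ k
  · have h1 : ContMDiff (ModelWithCorners.pi fun _ : S.Edge k => 𝓘(ℝ, E)) 𝓘(ℝ, E) ∞
        (L.holCoord h : (S.Edge k → G) → G) := by
      refine contMDiff_pathHol _ (fun e => ?_) _
      unfold GraphSystem.thetaInv
      cases S.next L.level e with
      | none => exact contMDiff_pi_apply _
      | some e' => exact (contMDiff_pi_apply _).mul (contMDiff_pi_apply _).inv
    have h3 : (fun g : S.Edge k → G => loopFun ρ L k g i j) =
        fun g => (ρ.toHom (L.holCoord h g) : Matrix (Fin N) (Fin N) ℂ) i j :=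
      funext fun g => by rw [loopFun, dif_pos h]
    rw [h3]
    exact (ρ.smooth i j).comp h1
  · have h3 : (fun g : S.Edge k → G => loopFun ρ L k g i j) =
        fun _ => (1 : Matrix (Fin N) (Fin N) ℂ) i j :=
      funext fun g => by rw [loopFun, dif_neg h]
    rw [h3]
    exact contMDiff_const

theorem holOp_of {k : ℕ} (h : L.level ≤ k) (ξ : L2A S N E G k) :
    holOp ρ L (HilbertLim.of (pull S N E G) k ξ) = HilbertLim.of (pull S N E G) k
      (mulL2 k (loopFun ρ L k) (continuous_loopFun ρ L k) (loopFun_mem ρ L k) ξ) :=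
  HilbertLim.lift_of _ _ _ _ h ξ

theorem Represents.holOp {k : ℕ} (h : L.level ≤ k) {f : (S.Edge k → G) → FibA S N E G k}
    {x : HilbertA S N E G} (hx : Represents f x) :
    Represents (fun g => Fib.matAct (loopFun ρ L k g) (f g)) (holOp ρ L x) := by
  obtain ⟨ξ, hξ, rfl⟩ := hx
  refine ⟨_, ?_, holOp_of ρ L h ξ⟩
  refine (mulL2_coe _ _ _ _ _).trans ?_
  filter_upwards [hξ] with g hg
  rw [hg]

set_option synthInstance.maxHeartbeats 200000 in
theorem norm_holOp (x : HilbertA S N E G) : ‖holOp ρ L x‖ = ‖x‖ := by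
  refine HilbertLim.induction_of (pull S N E G) (P := fun x => ‖holOp ρ L x‖ = ‖x‖) L.level
    (isClosed_eq (continuous_norm.comp (ContinuousLinearMap.continuous _)) continuous_norm)
    (fun k h ξ => ?_) x
  rw [holOp_of ρ L h, LinearIsometry.norm_map, LinearIsometry.norm_map, LinearIsometry.norm_map]

theorem holOp_holOp_reverse (x : HilbertA S N E G) : holOp ρ L (holOp ρ L.reverse x) = x := by
  refine HilbertLim.induction_of (pull S N E G)
    (P := fun x => holOp ρ L (holOp ρ L.reverse x) = x) L.level
    (isClosed_eq ((ContinuousLinearMap.continuous _).comp (ContinuousLinearMap.continuous _))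
      continuous_id) (fun k h ξ => ?_) x
  have h' : L.reverse.level ≤ k := h
  rw [holOp_of ρ _ h', holOp_of ρ _ h]
  congr 1
  ext1
  refine (mulL2_coe _ _ _ _ _).trans ?_
  filter_upwards [mulL2_coe k (loopFun ρ L.reverse k) (continuous_loopFun ρ L.reverse k)
    (loopFun_mem ρ L.reverse k) ξ] with g hg
  rw [hg, ← Fib.matAct_mul, (loopFun_reverse_mul ρ L k g).2, Fib.matAct_one]

/-- The generators of the loop algebra are thus closed under adjoints, so estimates for holonomy
operators cover the adjoints of generators as well. -/
theorem holOp_reverse : holOp ρ L.reverse =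
    (star (holOp ρ L) : HilbertA S N E G →L[ℂ] HilbertA S N E G) :=
  eq_adjoint_of_isometry (norm_holOp ρ L) (holOp_holOp_reverse ρ L)

end Loops

end LoopDirac

namespace LoopDirac

/-! ### The graph of `D` and its commutators with the loop algebra. -/

section DiracGraph

variable {V : Type*} {S : GraphSystem V} {N : ℕ}
variable {E : Type*} [NormedAddCommGroup E] [NormedSpace ℝ E] [FiniteDimensional ℝ E]
variable {G : Type*} [TopologicalSpace G] [ChartedSpace E G] [Group G] [LieGroup 𝓘(ℝ, E) ∞ G]
  [RiemannianBundle (fun x : G => TangentSpace 𝓘(ℝ, E) x)]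
  [IsTopologicalGroup G] [CompactSpace G] [SecondCountableTopology G]
  [MeasurableSpace G] [BorelSpace G]
variable {ι : Type*} [Fintype ι] (b : OrthonormalBasis ι ℝ (GroupLieAlgebra 𝓘(ℝ, E) G))
  (a : ∀ n, S.Edge n → ℝ)

/-- `x` is given by a smooth section `f` of level `n`, and `y` by `D n f`. -/
def DiracPair (n : ℕ) (x y : HilbertA S N E G) : Prop :=
  ∃ f : (S.Edge n → G) → FibA S N E G n, SmoothA E f ∧
    Represents f x ∧ Represents (diracLevel b a n f) y

variable {b a}

theorem DiracPair.succ {n : ℕ} {x y : HilbertA S N E G} (h : DiracPair b a n x y) :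
    DiracPair b a (n + 1) x y := by
  obtain ⟨f, hf, hx, hy⟩ := h
  exact ⟨pullFun f, hf.pullFun, hx.pullFun, by rw [diracLevel_pullFun b a hf]; exact hy.pullFun⟩

theorem DiracPair.of_le {n k : ℕ} (hk : n ≤ k) {x y : HilbertA S N E G}
    (h : DiracPair b a n x y) : DiracPair b a k x y := by
  induction k, hk using Nat.le_induction with
  | base => exact h
  | succ k _ ih => exact ih.succ

theorem DiracPair.add {n : ℕ} {x y x' y' : HilbertA S N E G} (h : DiracPair b a n x y)
    (h' : DiracPair b a n x' y') : DiracPair b a n (x + x') (y + y') := by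
  obtain ⟨f, hf, hx, hy⟩ := h
  obtain ⟨f', hf', hx', hy'⟩ := h'
  exact ⟨_, hf.add hf', hx.add hx', by rw [diracLevel_add b a hf hf']; exact hy.add hy'⟩

theorem DiracPair.smul {n : ℕ} {x y : HilbertA S N E G} (h : DiracPair b a n x y) (c : ℂ) :
    DiracPair b a n (c • x) (c • y) := by
  obtain ⟨f, hf, hx, hy⟩ := h
  exact ⟨_, hf.smul c, hx.smul c, by rw [diracLevel_smul b a hf]; exact hy.smul c⟩

theorem exists_diracPair {n : ℕ} {f : (S.Edge n → G) → FibA S N E G n} (hf : SmoothA E f) :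
    ∃ x y, Represents f x ∧ Represents (diracLevel b a n f) y ∧ DiracPair b a n x y := by
  obtain ⟨x, hx⟩ := exists_represents hf.continuous
  obtain ⟨y, hy⟩ := exists_represents (continuous_diracLevel b a hf)
  exact ⟨x, y, hx, hy, f, hf, hx, hy⟩

theorem diracPair_zero : DiracPair b a 0 (0 : HilbertA S N E G) 0 := by
  obtain ⟨x, y, _, _, h⟩ := exists_diracPair (b := b) (a := a)
    (f := fun _ : S.Edge 0 → G => (0 : FibA S N E G 0)) contMDiff_const
  -- Scaling any pair by `0` gives the zero pair, with no need to compute the operator on the zero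
  -- section.
  have h0 := h.smul 0
  rwa [zero_smul, zero_smul] at h0

/-- The operators `D n` are well defined on the elements of the direct limit. -/
theorem DiracPair.unique {n : ℕ} {x y y' : HilbertA S N E G} (h : DiracPair b a n x y)
    (h' : DiracPair b a n x y') : y = y' := by
  obtain ⟨f, hf, hx, hy⟩ := h
  obtain ⟨f', hf', hx', hy'⟩ := h'
  obtain rfl := hx.eq_of_continuous hx' hf.continuous hf'.continuous
  exact hy.unique hy'

-- Pairs can be raised to a common level and added there, so the generating set is already a
-- subspace and taking the span adds nothing.
variable (b a) in
theorem mem_span_diracPair {p : HilbertA S N E G × HilbertA S N E G} :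
    p ∈ Submodule.span ℂ {p : HilbertA S N E G × HilbertA S N E G |
      ∃ (n : ℕ) (f : (S.Edge n → G) → FibA S N E G n), SmoothA E f ∧
        Represents f p.1 ∧ Represents (diracLevel b a n f) p.2} ↔
      ∃ n, DiracPair b a n p.1 p.2 := by
  refine ⟨fun hp => ?_, fun hp => Submodule.subset_span hp⟩
  induction hp using Submodule.span_induction with
  | mem p hp => exact hp
  | zero => exact ⟨0, diracPair_zero⟩
  | add p q _ _ hp hq =>
    obtain ⟨n, hp⟩ := hp
    obtain ⟨m, hq⟩ := hq
    exact ⟨max n m, (hp.of_le (le_max_left n m)).add (hq.of_le (le_max_right n m))⟩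
  | smul c p _ hp =>
    obtain ⟨n, hp⟩ := hp
    exact ⟨n, hp.smul c⟩

variable (b a) in
/-- The graph of `D` consists of the pairs given by a smooth section `f` of some level `n` and by
`D n f`. -/
theorem mem_graph_dirac {x y : HilbertA S N E G} :
    (x, y) ∈ (dirac (N := N) b a).graph ↔ ∃ n, DiracPair b a n x y := by
  rw [dirac, Submodule.toLinearPMap_graph_eq]
  · exact mem_span_diracPair b a
  -- The subspace is the graph of an operator once `(0, y)` in it forces `y = 0`. This follows by
  -- comparison with the zero pair, raised to the same level.
  · rintro ⟨x, y⟩ hp hx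
    obtain ⟨n, hp⟩ := (mem_span_diracPair b a).1 hp
    obtain rfl : x = 0 := hx
    exact hp.unique (diracPair_zero.of_le (Nat.zero_le n))

/-- `D` may be computed from any smooth representative at hand: a witness at another level is
compared with it at the maximum of the two levels. -/
theorem mem_graph_dirac_iff_of_represents {n : ℕ} {f : (S.Edge n → G) → FibA S N E G n}
    (hf : SmoothA E f) {x y : HilbertA S N E G} (hx : Represents f x) :
    (x, y) ∈ (dirac (N := N) b a).graph ↔ Represents (diracLevel b a n f) y := by
  rw [mem_graph_dirac]
  refine ⟨fun ⟨m, h⟩ => ?_, fun hy => ⟨n, f, hf, hx, hy⟩⟩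
  obtain ⟨y', hy'⟩ := exists_represents (continuous_diracLevel b a hf)
  have h' : DiracPair b a n x y' := ⟨f, hf, hx, hy'⟩
  rwa [(h.of_le (le_max_left m n)).unique (h'.of_le (le_max_right m n))]

variable (ρ : UnitaryRep N E G) {v : V} (L : S.Loop v)

variable (b a) in
/-- The commutator of `h_L` and `D`, as an operator on sections of level `k`. -/
noncomputable def loopCommutator {k : ℕ} (h : L.level ≤ k)
    (f : (S.Edge k → G) → FibA S N E G k) (g : S.Edge k → G) : FibA S N E G k :=
  -∑ c : S.Edge L.level, coeff a L.level c • ∑ i, cliffA (S.incl h c) (b i)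
    (Fib.matAct (leftDerivMat (S.incl h c) (b i) (loopFun ρ L k) g) (f g))

theorem matAct_diracLevel_sub {k : ℕ} (h : L.level ≤ k)
    {f : (S.Edge k → G) → FibA S N E G k} (hf : SmoothA E f) (g : S.Edge k → G) :
    Fib.matAct (loopFun ρ L k g) (diracLevel b a k f g)
      - diracLevel b a k (fun g => Fib.matAct (loopFun ρ L k g) (f g)) g
    = Fib.matAct (loopFun ρ L k g) (diracAt b a h f g)
      - diracAt b a h (fun g => Fib.matAct (loopFun ρ L k g) (f g)) g := by
  rw [loopFun_eq_level ρ L h]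
  exact commutator_diracLevel b a h (smoothA_loopFun ρ L L.level) hf g

theorem matAct_diracAt_sub {k : ℕ} (h : L.level ≤ k)
    {f : (S.Edge k → G) → FibA S N E G k} (hf : SmoothA E f) (g : S.Edge k → G) :
    Fib.matAct (loopFun ρ L k g) (diracAt b a h f g)
      - diracAt b a h (fun g => Fib.matAct (loopFun ρ L k g) (f g)) g =
    loopCommutator b a ρ L h f g :=
  commutator_diracAt b a h (smoothA_loopFun ρ L k) hf g

-- The finitely many entries of derivatives form one continuous map from a compact space to a finite
-- product with the sup norm, so a single bound covers them all.
variable (b) in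
theorem exists_norm_leftDerivMat_loopFun_le :
    ∃ M : ℝ, ∀ (c : S.Edge L.level) (i : ι) (g : S.Edge L.level → G) (p q : Fin N),
      ‖leftDerivMat c (b i) (loopFun ρ L L.level) g p q‖ ≤ M := by
  have hc : Continuous fun (g : S.Edge L.level → G) (c : S.Edge L.level) (i : ι) (p q : Fin N) =>
      leftDerivMat c (b i) (loopFun ρ L L.level) g p q :=
    continuous_pi fun c => continuous_pi fun i => continuous_pi fun p => continuous_pi fun q =>
      (smoothA_loopFun ρ L L.level p q).continuous_leftDeriv c (b i)
  obtain ⟨M, hM⟩ := isCompact_univ.exists_bound_of_continuousOn hc.continuousOn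
  refine ⟨M, fun c i g p q => le_trans ?_ (hM g trivial)⟩
  exact (norm_le_pi_norm _ q).trans ((norm_le_pi_norm _ p).trans ((norm_le_pi_norm _ i).trans
    (norm_le_pi_norm (fun (c : S.Edge L.level) (i : ι) (p q : Fin N) =>
      leftDerivMat c (b i) (loopFun ρ L L.level) g p q) c)))

variable (b a) in
/-- The pointwise bound of the commutator of `h_L` and `D` is uniform in the levels. -/
theorem exists_norm_loopCommutator_le :
    ∃ C : ℝ, ∀ (k : ℕ) (h : L.level ≤ k) (f : (S.Edge k → G) → FibA S N E G k)
      (g : S.Edge k → G), ‖loopCommutator b a ρ L h f g‖ ≤ C * ‖f g‖ := by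
  obtain ⟨M, hM⟩ := exists_norm_leftDerivMat_loopFun_le b ρ L
  obtain ⟨C, hC, hA⟩ := Fib.exists_norm_matAct_le_mul N
  -- Here `M` bounds the derivatives of `h_L` at the level of `L`, and `C` is the fibre constant.
  -- Neither they nor the index sets involve `k`.
  refine ⟨∑ c : S.Edge L.level, ∑ _i : ι, ‖coeff a L.level c‖ * (C * M), fun k h f g => ?_⟩
  rw [loopCommutator, norm_neg, Finset.sum_mul]
  refine (norm_sum_le _ _).trans (Finset.sum_le_sum fun c _ => ?_)
  rw [norm_smul, ← Finset.mul_sum, mul_assoc, Finset.sum_mul]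
  refine mul_le_mul_of_nonneg_left ?_ (norm_nonneg _)
  refine (norm_sum_le _ _).trans (Finset.sum_le_sum fun i _ => ?_)
  -- Clifford multiplication by a basis vector drops out of the norm, and the derivative at level
  -- `k` is the one at the level of `L`, evaluated at the restricted point.
  rw [norm_cliffA _ (b.norm_eq_one i), loopFun_eq_level ρ L h, leftDerivMat_comp_incl]
  exact hA _ _ M (fun p q => hM c i _ p q) (f g)

theorem Represents.loopCommutator {k : ℕ} (h : L.level ≤ k)
    {f : (S.Edge k → G) → FibA S N E G k} (hf : SmoothA E f) {y z : HilbertA S N E G}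
    (hy : Represents (diracLevel b a k f) y)
    (hz : Represents (diracLevel b a k fun g => Fib.matAct (loopFun ρ L k g) (f g)) z) :
    Represents (loopCommutator b a ρ L h f) (LoopDirac.holOp ρ L y - z) := by
  have h1 := (hy.holOp ρ L h).sub hz
  simp only [matAct_diracLevel_sub ρ L h hf, matAct_diracAt_sub ρ L h hf] at h1
  exact h1

variable (b a) in
theorem exists_isBoundedCommutator_holOp :
    ∃ T, IsBoundedCommutator (holOp ρ L) (dirac b a) T := by
  obtain ⟨C, hC⟩ := exists_norm_loopCommutator_le b a ρ L
  refine exists_isBoundedCommutator (C := C) fun x y hxy => ?_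
  obtain ⟨n, hn⟩ := (mem_graph_dirac b a).1 hxy
  -- The section is raised to a level where the loop lives as well, since `h_L` acts there by its
  -- loop function.
  obtain ⟨f, hf, hx, hy⟩ := hn.of_le (le_max_left n L.level)
  have h := le_max_right n L.level
  have hf' := SmoothA.matAct (smoothA_loopFun ρ L (max n L.level)) hf
  obtain ⟨z, hz⟩ := exists_represents (continuous_diracLevel b a hf')
  refine ⟨z, (mem_graph_dirac_iff_of_represents hf' (hx.holOp ρ L h)).2 hz, ?_⟩
  exact (hy.loopCommutator ρ L h hf hz).norm_le hx fun g => hC _ h f g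

/-- Smooth sections lie in the domain, where every bounded extension is determined. The formula
therefore holds for any such `T`, however it was built. -/
theorem IsBoundedCommutator.represents {T : HilbertA S N E G →L[ℂ] HilbertA S N E G}
    (hT : IsBoundedCommutator (holOp ρ L) (dirac b a) T) {k : ℕ} (h : L.level ≤ k)
    {f : (S.Edge k → G) → FibA S N E G k} (hf : SmoothA E f) {x : HilbertA S N E G}
    (hx : Represents f x) : Represents (LoopDirac.loopCommutator b a ρ L h f) (T x) := by
  obtain ⟨y, hy⟩ := exists_represents (continuous_diracLevel b a hf)
  obtain ⟨z, hz, hTx⟩ := isBoundedCommutator_iff.1 hT x y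
    ((mem_graph_dirac_iff_of_represents hf hx).2 hy)
  have hz' := (mem_graph_dirac_iff_of_represents
    (SmoothA.matAct (smoothA_loopFun ρ L k) hf) (hx.holOp ρ L h)).1 hz
  rw [hTx]
  exact hy.loopCommutator ρ L h hf hz'

variable (b a) in
theorem exists_isBoundedCommutator_of_mem_loopAlgebra
    {B : HilbertA S N E G →L[ℂ] HilbertA S N E G} (hB : B ∈ loopAlgebra ρ S v) :
    ∃ T, IsBoundedCommutator B (dirac b a) T := by
  -- Having a bounded commutator is not visibly stable under adjoints, so the induction carries `B`
  -- and `star B` together. For a generator the second half is supplied by the reversed loop.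
  suffices h : (∃ T, IsBoundedCommutator B (dirac b a) T) ∧
      ∃ T, IsBoundedCommutator (star B) (dirac b a) T from h.1
  unfold loopAlgebra at hB
  induction hB using StarAlgebra.adjoin_induction with
  | mem B hB =>
    obtain ⟨L, rfl⟩ := hB
    exact ⟨exists_isBoundedCommutator_holOp b a ρ L,
      holOp_reverse ρ L ▸ exists_isBoundedCommutator_holOp b a ρ L.reverse⟩
  | algebraMap c =>
    refine ⟨⟨0, isBoundedCommutator_algebraMap c⟩, 0, ?_⟩
    rw [← algebraMap_star_comm]
    exact isBoundedCommutator_algebraMap _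
  | add B B' _ _ hB hB' =>
    obtain ⟨⟨T, hT⟩, T₁, hT₁⟩ := hB
    obtain ⟨⟨T', hT'⟩, T₁', hT₁'⟩ := hB'
    exact ⟨⟨_, hT.add hT'⟩, _, by rw [star_add]; exact hT₁.add hT₁'⟩
  | mul B B' _ _ hB hB' =>
    obtain ⟨⟨T, hT⟩, T₁, hT₁⟩ := hB
    obtain ⟨⟨T', hT'⟩, T₁', hT₁'⟩ := hB'
    exact ⟨⟨_, hT.mul hT'⟩, _, by rw [star_mul]; exact hT₁'.mul hT₁⟩
  | star B _ hB => exact ⟨hB.2, by rw [star_star]; exact hB.1⟩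

end DiracGraph

end LoopDirac

/-! ### The proposition. -/

theorem mainTheorem3
    {V : Type*} (S : GraphSystem V) (v : V)
    {E : Type*} [NormedAddCommGroup E] [NormedSpace ℝ E] [FiniteDimensional ℝ E]
    {G : Type*} [TopologicalSpace G] [ChartedSpace E G] [Group G] [LieGroup 𝓘(ℝ, E) ∞ G]
    [IsTopologicalGroup G] [T2Space G] [SecondCountableTopology G] [CompactSpace G]
    [ConnectedSpace G] [MeasurableSpace G] [BorelSpace G]
    [RiemannianBundle (fun x : G => TangentSpace 𝓘(ℝ, E) x)]
    [IsContMDiffRiemannianBundle 𝓘(ℝ, E) ∞ E (fun x : G => TangentSpace 𝓘(ℝ, E) x)]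
    (hG : IsBiInvariantMetric (E := E) G)
    {N : ℕ} (ρ : UnitaryRep N E G)
    {ι : Type*} [Fintype ι] (b : OrthonormalBasis ι ℝ (GroupLieAlgebra 𝓘(ℝ, E) G))
    (a : ∀ n, S.Edge n → ℝ) (ha : ∀ n c, a n c ≠ 0) :
    (∀ (n : ℕ) (f : (S.Edge n → G) → FibA S N E G n), SmoothA E f →
      ∃ x : (dirac b a).domain, Represents f (x : HilbertA S N E G) ∧
        Represents (diracLevel b a n f) (dirac b a x)) ∧
    (∀ B ∈ loopAlgebra ρ S v, ∃ T, IsBoundedCommutator B (dirac b a) T) ∧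
    (∀ L : S.Loop v, ∃ T, IsBoundedCommutator (holOp ρ L) (dirac b a) T ∧
      ∀ (k : ℕ) (h : L.level ≤ k) (f : (S.Edge k → G) → FibA S N E G k), SmoothA E f →
        SmoothA E (fun g => Fib.matAct (loopFun ρ L k g) (f g)) ∧
        (∀ g, Fib.matAct (loopFun ρ L k g) (diracLevel b a k f g)
              - diracLevel b a k (fun g => Fib.matAct (loopFun ρ L k g) (f g)) g
            = Fib.matAct (loopFun ρ L k g) (diracAt b a h f g)
              - diracAt b a h (fun g => Fib.matAct (loopFun ρ L k g) (f g)) g) ∧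
        (∀ g, Fib.matAct (loopFun ρ L k g) (diracAt b a h f g)
              - diracAt b a h (fun g => Fib.matAct (loopFun ρ L k g) (f g)) g
            = -∑ c : S.Edge L.level, coeff a L.level c • ∑ i, cliffA (S.incl h c) (b i)
                (Fib.matAct (leftDerivMat (S.incl h c) (b i) (loopFun ρ L k) g) (f g))) ∧
        ∀ x : HilbertA S N E G, Represents f x →
          Represents (fun g => -∑ c : S.Edge L.level, coeff a L.level c • ∑ i,
            cliffA (S.incl h c) (b i)
              (Fib.matAct (leftDerivMat (S.incl h c) (b i) (loopFun ρ L k) g) (f g))) (T x)) := by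
  refine ⟨fun n f hf => ?_, fun B hB => exists_isBoundedCommutator_of_mem_loopAlgebra b a ρ hB,
    fun L => ?_⟩
  · obtain ⟨x, y, hx, hy, h⟩ := exists_diracPair (b := b) (a := a) hf
    obtain ⟨x', hx' : (x' : HilbertA S N E G) = x, hy' : dirac b a x' = y⟩ :=
      (LinearPMap.mem_graph_iff _).1 ((mem_graph_dirac b a).2 ⟨n, h⟩)
    exact ⟨x', hx' ▸ hx, hy' ▸ hy⟩
  · obtain ⟨T, hT⟩ := exists_isBoundedCommutator_holOp b a ρ L
    exact ⟨T, hT, fun k h f hf => ⟨SmoothA.matAct (smoothA_loopFun ρ L k) hf,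
      matAct_diracLevel_sub ρ L h hf, matAct_diracAt_sub ρ L h hf,
      fun x hx => hT.represents ρ L h hf hx⟩⟩
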